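/- Let $g\in C^2(\mathbb R)$ be bounded and strictly increasing, with exactly one inflection point $x_0\in\mathbb R$, in the sense that $g$ is strictly convex on one of the half-lines $(-\infty,x_0]$, $[x_0,+\infty)$ and strictly concave on the other one; put $g(\pm\infty)=\lim_{s\to\pm\infty}g(s)$. Let $p:\mathbb R\to\mathbb R$ be bounded and continuous, and suppose that it has an asymptotic average $A(p)\in\mathbb R$, that is, $$\lim_{T\to+\infty}\frac1T\int_t^{t+T}p(s)\,ds=A(p)\qquad\text{uniformly in }t\in\mathbb R.$$ Consider the equation $$\ddot u+g(u)=p(t)\qquad(\ast)$$ and its solutions $u\in C^2(\mathbb R)$ defined on the whole line. Then the following are equivalent: (i) $(\ast)$ has a solution which is bounded on $\mathbb R$; (ii) $(\ast)$ has a solution which is bounded on $\mathbb R$ together with its first derivative; (iii) $g(-\infty)<A(p)<g(+\infty)$. If (iii) holds, there is a sequence $(u_m)$ of solutions of $(\ast)$ on $\mathbb R$, each bounded together with its first derivative, with $\|u_m\|_\infty=\sup_{t\in\mathbb R}|u_m(t)|\to\infty$ as $m\to\infty$, and such that each $u_m$ has infinitely many zeros and also takes the value $x_0$ infinitely many times (these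 two properties coincide under the normalization $x_0=0$). -/

import Mathlib

open Set Filter Topology

/-- A real function is bounded on the whole line. -/
def IsBoundedFun (f : ℝ → ℝ) : Prop :=
  ∃ M : ℝ, ∀ t : ℝ, |f t| ≤ M

/-- `x₀` is the one and only inflection point of `g : ℝ → ℝ`: the function `g` is strictly convex on
one side of `x₀` and strictly concave on the other side. -/
def IsOnlyInflectionPoint (g : ℝ → ℝ) (x₀ : ℝ) : Prop :=
  (StrictConvexOn ℝ (Iic x₀) g ∧ StrictConcaveOn ℝ (Ici x₀) g) ∨
    (StrictConcaveOn ℝ (Iic x₀) g ∧ StrictConvexOn ℝ (Ici x₀) g)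

/-- `A` is the asymptotic average of `p`: the mean of `p` over `[t, t + T]` tends to `A` as
`T → +∞`, uniformly in `t ∈ ℝ`. -/
def HasAsymptoticAverage (p : ℝ → ℝ) (A : ℝ) : Prop :=
  TendstoUniformly (fun T t : ℝ => (1 / T) * ∫ s in t..(t + T), p s) (fun _ => A) atTop

/-- `u` is a (classical) solution of `ü + g(u) = p(t)` on the whole real line. -/
def IsSolution (g p u : ℝ → ℝ) : Prop :=
  ContDiff ℝ 2 u ∧ ∀ t : ℝ, deriv (deriv u) t + g (u t) = p t

/-! Necessity: if `u` is bounded, so is `u'`, and integrating the equation shows that `p` and `g(u)`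
have the same mean. Since `g(u)` stays in a compact part of the open range of `g`, so does `A`
(`IsSolution.average_mem_Ioo`).

Sufficiency: since a bounded increasing function cannot be convex near `+∞`, the inflection must be
convex-concave, and translations reduce to `x₀ = 0`, `A = 0` (`exists_isBiNormalized`). The
reflection `u ↦ -u` exchanges the two half-lines, so only positive arcs need study. On a long
interval a positive solution vanishing at both ends feels a force that is `-α` on average, hence is
close to a parabola (`exists_arc`). Concavity of `g` on `[0, ∞)` provides a supersolution of the
linearised equation, so arcs are unique and depend on their endpoints in a Lipschitz way
(`exists_stability`, `exists_arc_close`).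

Arcs of alternating sign on consecutive intervals form a broken trajectory. Minus the action of an
arc on `[a, b]` has derivatives `u'(b)² / 2` and `-u'(a)² / 2` in its endpoints, so at a critical
point of the sum with respect to the nodes the slopes match and the arcs join into one solution.
Minus the action is also asymptotically `α² / 24 * (b - a) ^ 3` (`exists_arc_family`).

Critical nodes are found by minimisation. Minimising a sum of cubic costs with a free number of
nodes would favour short gaps, on which arcs need not exist; a fixed price per gap counters this and
keeps all gaps between `τ` and `Λ * τ`, with the constraint inactive
(`exists_critical_subdivision`). The resulting solutions on `[-L, L]` satisfy bounds independent of
`L`, and a limit `L → ∞` yields a solution on the line that oscillates between high positive and low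
negative values (`IsBiNormalized.exists_oscillating`). Larger `τ` means larger amplitude. -/

/-! ### Subdivisions of an interval and their minimisation -/

/-- `t 0 = a`, …, `t n = b` is a subdivision with gaps at least `τ`. -/
structure IsSubdivision (τ a b : ℝ) (n : ℕ) (t : ℕ → ℝ) : Prop where
  left : t 0 = a
  right : t n = b
  gap : ∀ k < n, τ ≤ t (k + 1) - t k

/-- The cost of a subdivision, with a price `μ` for each of its gaps. -/
def subdivisionCost (f : ℕ → ℝ → ℝ → ℝ) (μ : ℝ) (n : ℕ) (t : ℕ → ℝ) : ℝ :=
  ∑ i ∈ Finset.range n, (f i (t i) (t (i + 1)) + μ)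

namespace IsSubdivision

variable {f : ℕ → ℝ → ℝ → ℝ} {μ τ a b : ℝ} {n : ℕ} {t : ℕ → ℝ}

lemma le_of_le (hτ : 0 ≤ τ) (h : IsSubdivision τ a b n t) {i j : ℕ} (hij : i ≤ j) (hj : j ≤ n) :
    t i ≤ t j := by
  induction j, hij using Nat.le_induction with
  | base => exact le_rfl
  | succ j hij ih => linarith [ih (by omega), h.gap j (by omega)]

/-- Bounds the number of gaps, so that a minimum over subdivisions of every length involves only
finitely many lengths. -/
lemma mul_le (h : IsSubdivision τ a b n t) : n * τ ≤ b - a := by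
  have := Finset.sum_le_sum (s := Finset.range n) (f := fun _ => τ)
    (g := fun i => t (i + 1) - t i) fun i hi => h.gap i (Finset.mem_range.mp hi)
  rw [Finset.sum_range_sub, h.left, h.right] at this
  simpa using this

/-- Nodes are inserted in pairs: later indices shift by two, which a 2-periodic sequence of costs
does not see. In the application the parity of an index is the sign of its arc. -/
lemma exists_insert (hf : ∀ k, f (k + 2) = f k) (h : IsSubdivision τ a b n t) {k : ℕ} (hk : k < n)
    {x y : ℝ} (hx : τ ≤ x - t k) (hxy : τ ≤ y - x) (hy : τ ≤ t (k + 1) - y) :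
    ∃ t', IsSubdivision τ a b (n + 2) t' ∧ subdivisionCost f μ (n + 2) t' = subdivisionCost f μ n t
      - f k (t k) (t (k + 1)) + (f k (t k) x + f (k + 1) x y + f k y (t (k + 1))) + 2 * μ := by
  obtain ⟨r, rfl⟩ : ∃ r, n = k + 1 + r := ⟨n - (k + 1), by omega⟩
  set t' : ℕ → ℝ := fun i => if i ≤ k then t i else if i = k + 1 then x else
    if i = k + 2 then y else t (i - 2) with ht'
  have e0 : ∀ i ≤ k, t' i = t i := fun i hi => by simp [ht', hi]
  have e1 : t' (k + 1) = x := by simp [ht']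
  have e2 : t' (k + 2) = y := by simp [ht']
  have e3 : ∀ j, t' (k + 3 + j) = t (k + 1 + j) := fun j => by
    have h1 : ¬ k + 3 + j ≤ k := by omega
    have h2 : ¬ k + 3 + j = k + 1 := by omega
    have h3 : ¬ k + 3 + j = k + 2 := by omega
    simp only [ht', h1, h2, h3, if_false]
    congr 1; omega
  refine ⟨t', ⟨?_, ?_, ?_⟩, ?_⟩
  · rw [e0 0 (by omega), h.left]
  · have := e3 r
    rw [show k + 1 + r + 2 = k + 3 + r by ring, this, h.right]
  · intro i hi
    rcases lt_trichotomy i k with hik | rfl | hik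
    · rw [e0 i hik.le, e0 (i + 1) hik]; exact h.gap i (by omega)
    · rw [e0 i le_rfl, e1]; exact hx
    · obtain rfl | rfl | ⟨j, rfl⟩ : i = k + 1 ∨ i = k + 2 ∨ ∃ j, i = k + 3 + j := by
        rcases Nat.lt_or_ge i (k + 3) with h3 | h3
        · omega
        · exact Or.inr (Or.inr ⟨i - (k + 3), by omega⟩)
      · rw [e1, show k + 1 + 1 = k + 2 by ring, e2]; exact hxy
      · rw [e2, show k + 2 + 1 = k + 3 + 0 by ring, e3]; exact hy
      · rw [e3, show k + 3 + j + 1 = k + 3 + (j + 1) by ring, e3]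
        exact h.gap (k + 1 + j) (by omega)
  · have p3 : ∀ j, f (k + 3 + j) = f (k + 1 + j) := fun j => by
      rw [show k + 3 + j = k + 1 + j + 2 by ring, hf]
    have s1 : ∑ i ∈ Finset.range k, (f i (t' i) (t' (i + 1)) + μ)
        = ∑ i ∈ Finset.range k, (f i (t i) (t (i + 1)) + μ) :=
      Finset.sum_congr rfl fun i hi => by
        have := Finset.mem_range.mp hi
        rw [e0 i this.le, e0 (i + 1) this]
    have s2 : ∑ j ∈ Finset.range r, (f (k + 3 + j) (t' (k + 3 + j)) (t' (k + 3 + j + 1)) + μ)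
        = ∑ j ∈ Finset.range r, (f (k + 1 + j) (t (k + 1 + j)) (t (k + 1 + j + 1)) + μ) :=
      Finset.sum_congr rfl fun j _ => by
        rw [p3, e3, show k + 3 + j + 1 = k + 3 + (j + 1) by ring, e3]; rfl
    unfold subdivisionCost
    rw [show k + 1 + r + 2 = k + 3 + r by ring, Finset.sum_range_add _ (k + 3),
      Finset.sum_range_add _ (k + 1), s2,
      Finset.sum_range_succ, Finset.sum_range_succ, Finset.sum_range_succ, s1,
      Finset.sum_range_succ, e0 k le_rfl, e1, show k + 1 + 1 = k + 2 by ring, e2,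
      show k + 2 + 1 = k + 3 + 0 by ring, e3, hf k]
    simp only [add_zero]
    ring

/-- Again two nodes at a time, to preserve parity; three consecutive gaps merge into one with the
cost of the first. -/
lemma exists_remove (hτ : 0 ≤ τ) (hf : ∀ k, f (k + 2) = f k) (h : IsSubdivision τ a b n t) {k : ℕ}
    (hk : k + 2 < n) :
    ∃ t', IsSubdivision τ a b (n - 2) t' ∧ subdivisionCost f μ (n - 2) t' = subdivisionCost f μ n t
      + f k (t k) (t (k + 3)) - (f k (t k) (t (k + 1)) + f (k + 1) (t (k + 1)) (t (k + 2))
        + f (k + 2) (t (k + 2)) (t (k + 3))) - 2 * μ := by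
  obtain ⟨r, rfl⟩ : ∃ r, n = k + 3 + r := ⟨n - (k + 3), by omega⟩
  set t' : ℕ → ℝ := fun i => if i ≤ k then t i else t (i + 2) with ht'
  have e0 : ∀ i ≤ k, t' i = t i := fun i hi => by simp [ht', hi]
  have e3 : ∀ j, t' (k + 1 + j) = t (k + 3 + j) := fun j => by
    have h1 : ¬ k + 1 + j ≤ k := by omega
    simp only [ht', h1, if_false]
    congr 1; ring
  have hn : k + 3 + r - 2 = k + 1 + r := by omega
  rw [hn]
  refine ⟨t', ⟨?_, ?_, ?_⟩, ?_⟩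
  · rw [e0 0 (by omega), h.left]
  · rw [e3, h.right]
  · intro i hi
    rcases lt_trichotomy i k with hik | rfl | hik
    · rw [e0 i hik.le, e0 (i + 1) hik]; exact h.gap i (by omega)
    · rw [e0 i le_rfl, show i + 1 = i + 1 + 0 by ring, e3]
      have h1 := h.gap i (by omega)
      have h2 : t (i + 1) ≤ t (i + 3 + 0) := h.le_of_le hτ (by omega) (by omega)
      linarith
    · obtain ⟨j, rfl⟩ : ∃ j, i = k + 1 + j := ⟨i - (k + 1), by omega⟩
      rw [e3, show k + 1 + j + 1 = k + 1 + (j + 1) by ring, e3]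
      exact h.gap (k + 3 + j) (by omega)
  · have p3 : ∀ j, f (k + 3 + j) = f (k + 1 + j) := fun j => by
      rw [show k + 3 + j = k + 1 + j + 2 by ring, hf]
    have s1 : ∑ i ∈ Finset.range k, (f i (t' i) (t' (i + 1)) + μ)
        = ∑ i ∈ Finset.range k, (f i (t i) (t (i + 1)) + μ) :=
      Finset.sum_congr rfl fun i hi => by
        have := Finset.mem_range.mp hi
        rw [e0 i this.le, e0 (i + 1) this]
    have s2 : ∑ j ∈ Finset.range r, (f (k + 1 + j) (t' (k + 1 + j)) (t' (k + 1 + j + 1)) + μ)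
        = ∑ j ∈ Finset.range r, (f (k + 3 + j) (t (k + 3 + j)) (t (k + 3 + j + 1)) + μ) :=
      Finset.sum_congr rfl fun j _ => by
        rw [p3, e3, show k + 1 + j + 1 = k + 1 + (j + 1) by ring, e3]; rfl
    unfold subdivisionCost
    rw [Finset.sum_range_add _ (k + 1), Finset.sum_range_add _ (k + 3), s2,
      Finset.sum_range_succ, s1, Finset.sum_range_succ, Finset.sum_range_succ,
      Finset.sum_range_succ, e0 k le_rfl,
      show k + 1 = k + 1 + 0 by ring, e3]
    simp only [add_zero]
    ring

lemma move (h : IsSubdivision τ a b n t) {k : ℕ} (hk : k + 1 < n) {s : ℝ} (h1 : τ ≤ s - t k)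
    (h2 : τ ≤ t (k + 2) - s) :
    IsSubdivision τ a b n (Function.update t (k + 1) s) ∧
      subdivisionCost f μ n (Function.update t (k + 1) s) = subdivisionCost f μ n t
      - (f k (t k) (t (k + 1)) + f (k + 1) (t (k + 1)) (t (k + 2)))
      + (f k (t k) s + f (k + 1) s (t (k + 2))) := by
  obtain ⟨r, rfl⟩ : ∃ r, n = k + 2 + r := ⟨n - (k + 2), by omega⟩
  have e : ∀ i, i ≠ k + 1 → Function.update t (k + 1) s i = t i := fun i hi =>
    Function.update_of_ne hi _ _
  have e1 : Function.update t (k + 1) s (k + 1) = s := Function.update_self _ _ _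
  refine ⟨⟨?_, ?_, ?_⟩, ?_⟩
  · rw [e _ (by omega), h.left]
  · rw [e _ (by omega), h.right]
  · intro i hi
    by_cases h3 : i = k + 1
    · subst h3
      rw [e1, e _ (by omega)]; exact h2
    · by_cases h4 : i = k
      · subst h4
        rw [e1, e _ (by omega)]; exact h1
      · rw [e _ h3, e _ (by omega)]; exact h.gap i hi
  · unfold subdivisionCost
    have s1 : ∑ i ∈ Finset.range k,
          (f i (Function.update t (k + 1) s i) (Function.update t (k + 1) s (i + 1)) + μ)
        = ∑ i ∈ Finset.range k, (f i (t i) (t (i + 1)) + μ) :=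
      Finset.sum_congr rfl fun i hi => by
        have := Finset.mem_range.mp hi
        rw [e _ (by omega), e _ (by omega)]
    have s2 : ∑ j ∈ Finset.range r, (f (k + 2 + j) (Function.update t (k + 1) s (k + 2 + j))
          (Function.update t (k + 1) s (k + 2 + j + 1)) + μ)
        = ∑ j ∈ Finset.range r, (f (k + 2 + j) (t (k + 2 + j)) (t (k + 2 + j + 1)) + μ) :=
      Finset.sum_congr rfl fun j _ => by
        rw [e _ (by omega), e _ (by omega)]
    rw [Finset.sum_range_add _ (k + 2), Finset.sum_range_add _ (k + 2), s2, Finset.sum_range_succ,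
      Finset.sum_range_succ, s1, Finset.sum_range_succ, Finset.sum_range_succ, e1,
      e k (by omega), e (k + 1 + 1) (by omega)]
    ring

/-- A subdivision of least cost, among those with a given number of gaps. -/
lemma exists_min_of_length (hτ : 0 ≤ τ)
    (hf : ∀ k, ContinuousOn (fun q : ℝ × ℝ => f k q.1 q.2) {q | τ ≤ q.2 - q.1}) (n : ℕ)
    (hne : ∃ t, IsSubdivision τ a b n t) :
    ∃ t, IsSubdivision τ a b n t ∧ ∀ t', IsSubdivision τ a b n t' → subdivisionCost f μ n t ≤ subdivisionCost f μ n t' := by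
  set S : Set (ℕ → ℝ) := (univ.pi fun _ => Icc a b) ∩ {t | IsSubdivision τ a b n t} with hS
  have hcl : IsClosed {t : ℕ → ℝ | IsSubdivision τ a b n t} := by
    have : {t : ℕ → ℝ | IsSubdivision τ a b n t} =
        {t | t 0 = a} ∩ ({t | t n = b} ∩ ⋂ k, ⋂ (_ : k < n), {t | τ ≤ t (k + 1) - t k}) := by
      ext t
      simp only [mem_ofPred_eq, mem_inter_iff, mem_iInter]
      exact ⟨fun h => ⟨h.left, h.right, h.gap⟩, fun h => ⟨h.1, h.2.1, h.2.2⟩⟩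
    rw [this]
    refine (isClosed_eq (by fun_prop) (by fun_prop)).inter
      ((isClosed_eq (by fun_prop) (by fun_prop)).inter ?_)
    exact isClosed_iInter fun k => isClosed_iInter fun _ =>
      isClosed_le (by fun_prop) (by fun_prop)
  have hcomp : IsCompact S := (isCompact_univ_pi fun _ => isCompact_Icc).inter_right hcl
  -- Entries after `n` are unconstrained. Replacing them by `t n = b` changes nothing in the cost
  -- and puts the sequence into a compact cube.
  have hproj : ∀ t, IsSubdivision τ a b n t → (fun i => t (min i n)) ∈ S ∧
      subdivisionCost f μ n (fun i => t (min i n)) = subdivisionCost f μ n t := by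
    intro t ht
    refine ⟨⟨fun i _ => ⟨?_, ?_⟩, ⟨?_, ?_, fun k hk => ?_⟩⟩, ?_⟩
    · rw [← ht.left]; exact ht.le_of_le hτ (Nat.zero_le _) (min_le_right _ _)
    · rw [← ht.right]; exact ht.le_of_le hτ (min_le_right _ _) le_rfl
    · simpa using ht.left
    · simpa using ht.right
    · simp only [min_eq_left hk.le, min_eq_left (Nat.succ_le_of_lt hk)]
      exact ht.gap k hk
    · refine Finset.sum_congr rfl fun i hi => ?_
      have := Finset.mem_range.mp hi
      simp only [min_eq_left this.le, min_eq_left (Nat.succ_le_of_lt this)]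
  have hcont : ContinuousOn (subdivisionCost f μ n) S := by
    unfold subdivisionCost
    refine continuousOn_finsetSum _ fun i hi => ContinuousOn.add ?_ continuousOn_const
    exact (hf i).comp (f := fun t : ℕ → ℝ => (t i, t (i + 1))) (by fun_prop)
      fun t ht => ht.2.gap i (Finset.mem_range.mp hi)
  obtain ⟨t0, ht0⟩ := hne
  obtain ⟨t, htS, htmin⟩ := hcomp.exists_isMinOn ⟨_, (hproj t0 ht0).1⟩ hcont
  refine ⟨t, htS.2, fun t' ht' => ?_⟩
  rw [← (hproj t' ht').2]
  exact htmin (hproj t' ht').1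

/-- A subdivision of least cost. -/
lemma exists_min (hτ : 0 < τ)
    (hf : ∀ k, ContinuousOn (fun q : ℝ × ℝ => f k q.1 q.2) {q | τ ≤ q.2 - q.1}) (μ : ℝ)
    (hab : τ ≤ b - a) :
    ∃ n t, IsSubdivision τ a b n t ∧
      ∀ n' t', IsSubdivision τ a b n' t' → subdivisionCost f μ n t ≤ subdivisionCost f μ n' t' := by
  classical
  set N := (Finset.range (⌊(b - a) / τ⌋₊ + 1)).filter fun n => ∃ t, IsSubdivision τ a b n t with hN
  have hmem : ∀ n t, IsSubdivision τ a b n t → n ∈ N := by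
    intro n t h
    refine Finset.mem_filter.mpr ⟨Finset.mem_range.mpr (Nat.lt_succ_of_le (Nat.le_floor ?_)), t, h⟩
    rw [le_div_iff₀ hτ]
    exact h.mul_le
  have h1 : IsSubdivision τ a b 1 (fun i => if i = 0 then a else b) := by
    refine ⟨by simp, by simp, fun k hk => ?_⟩
    obtain rfl : k = 0 := by omega
    simpa using hab
  choose! T hT hTmin using fun n (hn : ∃ t, IsSubdivision τ a b n t) =>
    exists_min_of_length (μ := μ) hτ.le hf n hn
  obtain ⟨n, hn, hmin⟩ := N.exists_min_image (fun n => subdivisionCost f μ n (T n)) ⟨1, hmem _ _ h1⟩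
  have hn' := (Finset.mem_filter.mp hn).2
  exact ⟨n, T n, hT n hn', fun n' t' h' =>
    (hmin n' (hmem _ _ h')).trans (hTmin n' ⟨t', h'⟩ t' h')⟩

end IsSubdivision

/-! ### Cubic costs and critical chains -/

/-- Moving a point which cuts off too small a gap lowers a cubic cost. -/
lemma cubic_rebalance_lt {c₀ C θ ε cx cy x y : ℝ} (hc₀ : 0 < c₀) (hC : c₀ ≤ C)
    (hθ : θ = c₀ / (4 * C)) (hε : ε = c₀ * θ / 16) (hx : c₀ ≤ cx ∧ cx ≤ C) (hy : c₀ ≤ cy ∧ cy ≤ C)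
    (hx0 : 0 < x) (hxy : 3 / θ ^ 2 * x < y) :
    (cx + ε) * (θ * (x + y)) ^ 3 + (cy + ε) * ((1 - θ) * (x + y)) ^ 3 < (cy - ε) * y ^ 3 := by
  have hC0 : 0 < C := hc₀.trans_le hC
  have hθ0 : 0 < θ := by rw [hθ]; positivity
  have hcθ : c₀ = 4 * C * θ := by rw [hθ]; field_simp
  have hθ1 : θ ≤ 1 / 4 := by
    have h : C * (4 * θ) ≤ C * 1 := by linarith
    linarith [le_of_mul_le_mul_left h hC0]
  have hε0 : 0 < ε := by rw [hε]; positivity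
  have hεle : ε ≤ c₀ / 64 := by rw [hε]; nlinarith
  set S := x + y with hS
  have h3 : 3 * x < θ ^ 2 * y := by
    rw [div_mul_eq_mul_div, div_lt_iff₀ (by positivity)] at hxy; linarith
  have hy0 : 0 < y := by
    have : 0 < θ ^ 2 * y := by linarith
    exact pos_of_mul_pos_right this (by positivity)
  have hS0 : 0 < S := by positivity
  set r := x / S with hr
  have hr0 : 0 < r := by positivity
  have hr3 : 3 * r < θ ^ 2 := by
    rw [hr, ← mul_div_assoc, div_lt_iff₀ hS0, hS]
    nlinarith [sq_nonneg θ]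
  have hyr : y = (1 - r) * S := by rw [hr]; field_simp; rw [hS]; ring
  have hS3 : 0 < S ^ 3 := by positivity
  rw [hyr, mul_pow, mul_pow, mul_pow, ← mul_assoc, ← mul_assoc, ← mul_assoc, ← add_mul]
  refine mul_lt_mul_of_pos_right ?_ hS3
  have hr1 : r < 1 := by nlinarith
  -- After division by `S ^ 3`, passing from `cy` to `cy * (1 - θ)` saves at least `c₀ * θ`. The new
  -- short piece costs at most `c₀ * θ / 16`, the three errors `ε` as much each, and the old short
  -- gap accounts for at most `C * θ ^ 2 = c₀ * θ / 4`: half of the saving in all.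
  have e1 : (1 - r) ^ 3 ≥ 1 - 3 * r := by nlinarith [mul_pos hr0 hr0, sq_nonneg r]
  have e2 : (1 - θ) ^ 3 ≤ 1 - θ := by
    have h0 : 0 ≤ 1 - θ := by linarith
    have : (1 - θ) ^ 2 ≤ 1 := by nlinarith
    calc (1 - θ) ^ 3 = (1 - θ) ^ 2 * (1 - θ) := by ring
      _ ≤ 1 * (1 - θ) := mul_le_mul_of_nonneg_right this h0
      _ = 1 - θ := one_mul _
  have e3 : (cy - ε) * (1 - 3 * r) ≤ (cy - ε) * (1 - r) ^ 3 :=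
    mul_le_mul_of_nonneg_left e1 (by linarith)
  have e4 : (cy + ε) * (1 - θ) ^ 3 ≤ (cy + ε) * (1 - θ) :=
    mul_le_mul_of_nonneg_left e2 (by linarith)
  have hθ3 : θ ^ 3 ≤ 1 := pow_le_one₀ hθ0.le (by linarith)
  have e5 : (cx + ε) * θ ^ 3 ≤ C * θ ^ 3 + ε := by nlinarith [pow_pos hθ0 3]
  have e6 : C * θ ^ 3 ≤ c₀ * θ / 16 := by rw [hcθ]; nlinarith [pow_pos hθ0 2, mul_pos hC0 (pow_pos hθ0 2)]
  have e7 : (cy - ε) * (3 * r) ≤ c₀ * θ / 4 := by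
    have : (cy - ε) * (3 * r) ≤ C * θ ^ 2 :=
      mul_le_mul (by linarith) hr3.le (by positivity) hC0.le
    rw [hcθ]; nlinarith
  have e8 : c₀ * θ ≤ cy * θ := mul_le_mul_of_nonneg_right hy.1 hθ0.le
  have e9 : 0 < c₀ * θ := by positivity
  nlinarith [mul_pos hε0 hθ0]

/-- Cutting a gap into three lowers a cubic cost substantially. -/
lemma cubic_split_le {c₀ C θ ε c c' D : ℝ} (hc₀ : 0 < c₀) (hC : c₀ ≤ C)
    (hθ : θ = c₀ / (4 * C)) (hε : ε = c₀ * θ / 16) (hc : c₀ ≤ c) (hc' : c' ≤ C) (hD : 0 ≤ D) :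
    2 * ((c + ε) * ((1 - θ) / 2 * D) ^ 3) + (c' + ε) * (θ * D) ^ 3 + c₀ / 2 * D ^ 3
      ≤ (c - ε) * D ^ 3 := by
  have hC0 : 0 < C := hc₀.trans_le hC
  have hθ0 : 0 < θ := by rw [hθ]; positivity
  have hcθ : c₀ = 4 * C * θ := by rw [hθ]; field_simp
  have hθ1 : θ ≤ 1 / 4 := by
    have h : C * (4 * θ) ≤ C * 1 := by linarith
    linarith [le_of_mul_le_mul_left h hC0]
  have hε0 : 0 < ε := by rw [hε]; positivity
  have hεle : ε ≤ c₀ / 64 := by rw [hε]; nlinarith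
  -- The two outer pieces together cost about a quarter of the original. The middle piece has the
  -- other coefficient, possibly much larger than `c`, and is therefore given only the fraction `θ`
  -- of the length.
  have e1 : ((1 - θ) / 2) ^ 3 ≤ 1 / 8 := by
    calc ((1 - θ) / 2) ^ 3 ≤ (1 / 2) ^ 3 := by gcongr <;> linarith
      _ = 1 / 8 := by norm_num
  have e2 : (c + ε) * ((1 - θ) / 2) ^ 3 ≤ (c + ε) * (1 / 8) :=
    mul_le_mul_of_nonneg_left e1 (by linarith)
  have e3 : (c' + ε) * θ ^ 3 ≤ c₀ / 32 := by
    have h1 : (c' + ε) * θ ^ 3 ≤ (2 * C) * θ ^ 3 := by gcongr; linarith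
    have h2 : (2 * C) * θ ^ 3 ≤ c₀ / 32 := by
      rw [hcθ]; nlinarith [mul_pos hC0 hθ0, mul_pos (mul_pos hC0 hθ0) hθ0]
    linarith
  have hD3 : 0 ≤ D ^ 3 := by positivity
  have : 2 * ((c + ε) * ((1 - θ) / 2) ^ 3) + (c' + ε) * θ ^ 3 + c₀ / 2 ≤ c - ε := by linarith
  have := mul_le_mul_of_nonneg_right this hD3
  rw [mul_pow, mul_pow]
  linarith

set_option maxHeartbeats 1000000 in
/-- A 2-periodic sequence of approximately cubic costs has chains of critical points, with gaps
under control, across every sufficiently long interval. -/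
theorem exists_critical_subdivision {c₀ C : ℝ} (hc₀ : 0 < c₀) (hC : c₀ ≤ C) :
    ∃ ε > 0, ∃ Λ > 0, ∀ (c : ℕ → ℝ) (f : ℕ → ℝ → ℝ → ℝ) (τ : ℝ), 0 < τ →
      (∀ k, c₀ ≤ c k ∧ c k ≤ C) → (∀ k, f (k + 2) = f k) →
      (∀ k x y, τ ≤ y - x → |f k x y - c k * (y - x) ^ 3| ≤ ε * (y - x) ^ 3) →
      (∀ k, ContinuousOn (fun q : ℝ × ℝ => f k q.1 q.2) {q | τ ≤ q.2 - q.1}) →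
      ∀ a b, Λ * τ < b - a → ∃ (n : ℕ) (t : ℕ → ℝ), t 0 = a ∧ t n = b ∧
        (∀ k < n, τ < t (k + 1) - t k ∧ t (k + 1) - t k ≤ Λ * τ) ∧
        ∀ k, k + 1 < n →
          IsLocalMin (fun s => f k (t k) s + f (k + 1) s (t (k + 2))) (t (k + 1)) := by
  have hC0 : 0 < C := hc₀.trans_le hC
  obtain ⟨θ, hθ⟩ : ∃ θ, θ = c₀ / (4 * C) := ⟨_, rfl⟩
  have hθ0 : 0 < θ := by rw [hθ]; positivity
  have hcθ : c₀ = 4 * C * θ := by rw [hθ]; field_simp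
  have hθ1 : θ ≤ 1 / 4 := by
    have h : C * (4 * θ) ≤ C * 1 := by linarith
    linarith [le_of_mul_le_mul_left h hC0]
  obtain ⟨ε, hε⟩ : ∃ ε, ε = c₀ * θ / 16 := ⟨_, rfl⟩
  have hε0 : 0 < ε := by rw [hε]; positivity
  have hεle : ε ≤ c₀ / 64 := by rw [hε]; nlinarith
  -- `B` is the ratio of adjacent gaps beyond which `cubic_rebalance_lt` lowers the cost.
  obtain ⟨B, hB⟩ : ∃ B, B = 3 / θ ^ 2 := ⟨_, rfl⟩
  have hBθ : B * θ ^ 2 = 3 := by rw [hB]; field_simp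
  have hB0 : 0 < B := by rw [hB]; positivity
  have hBθ1 : 12 ≤ B * θ := by nlinarith [mul_pos hB0 hθ0]
  have hB1 : 48 ≤ B := by nlinarith
  -- If three consecutive gaps have total length at least `P * τ` and each is at most `B ^ 2` times
  -- a given one, the given one is at least `4 / 3 * τ`.
  set P : ℝ := 4 * B ^ 2 with hP
  have hP0 : 0 < P := by positivity
  have hPB : B ≤ P := by rw [hP]; nlinarith
  have hPθ : P ≤ P / θ := by
    rw [le_div_iff₀ hθ0]; exact mul_le_of_le_one_right hP0.le (by linarith)
  -- Gaps will turn out to be at most `P / θ * τ`. The factor 3 then forces at least three of them,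
  -- so that every gap belongs to a triple.
  refine ⟨ε, hε0, 3 * (P / θ), by positivity, ?_⟩
  intro c f τ hτ hc hf hest hcont a b hab
  set Λ := 3 * (P / θ) with hΛdef
  have hΛ1 : 1 ≤ Λ := by linarith
  -- Guarantees that the pieces produced by the two cubic lemmas are admissible, that is, at least
  -- `τ` long.
  have hcut : ∀ S, B * τ ≤ S → τ ≤ θ * S ∧ τ ≤ (1 - θ) / 2 * S ∧ τ ≤ (1 - θ) * S := by
    intro S hS
    have h1 : θ * (B * τ) ≤ θ * S := mul_le_mul_of_nonneg_left hS hθ0.le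
    have h2 : 12 * τ ≤ (B * θ) * τ := mul_le_mul_of_nonneg_right hBθ1 hτ.le
    have h3 : 48 * τ ≤ B * τ := mul_le_mul_of_nonneg_right hB1 hτ.le
    have hS0 : 0 < S := by linarith
    have h4 : θ * S ≤ 1 / 4 * S := mul_le_mul_of_nonneg_right hθ1 hS0.le
    refine ⟨by linarith, by linarith, by linarith⟩
  have hBτ : ∀ x, τ ≤ x → B * τ ≤ B * x := fun x hx => mul_le_mul_of_nonneg_left hx hB0.le
  -- The price balances two competitors. Cutting a gap longer than `P / θ * τ` into three saves more
  -- than the `2 * μ` it costs; merging three gaps of total length below `P * τ` recovers `2 * μ`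
  -- and costs less than that.
  set μ := C * (P * τ) ^ 3 with hμ
  obtain ⟨n, t, ht, hmin⟩ := IsSubdivision.exists_min hτ hcont μ (a := a) (b := b)
    ((le_mul_of_one_le_left hτ.le hΛ1).trans hab.le)
  have hup : ∀ k x y, τ ≤ y - x → f k x y ≤ (c k + ε) * (y - x) ^ 3 := fun k x y h => by
    have := (abs_le.mp (hest k x y h)).2; linarith
  have hlo : ∀ k x y, τ ≤ y - x → (c k - ε) * (y - x) ^ 3 ≤ f k x y := fun k x y h => by
    have := (abs_le.mp (hest k x y h)).1; linarith
  have hnn : ∀ k x y, τ ≤ y - x → 0 ≤ f k x y := fun k x y h =>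
    le_trans (mul_nonneg (by linarith [(hc k).1]) (pow_nonneg (by linarith) 3)) (hlo k x y h)
  -- upper bound for the gaps
  have hgap : ∀ k < n, t (k + 1) - t k ≤ P / θ * τ := by
    intro k hk
    by_contra! hD
    set D := t (k + 1) - t k with hDdef
    have hPτ : P * τ ≤ P / θ * τ := mul_le_mul_of_nonneg_right hPθ hτ.le
    have hDB : B * τ ≤ D :=
      (mul_le_mul_of_nonneg_right hPB hτ.le).trans (hPτ.trans hD.le)
    have hD0 : 0 < D := hτ.trans_le (ht.gap k hk)
    obtain ⟨h2, h1, -⟩ := hcut D hDB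
    obtain ⟨t', ht', hcost⟩ := ht.exists_insert (μ := μ) hf hk (x := t k + (1 - θ) / 2 * D)
      (y := t (k + 1) - (1 - θ) / 2 * D) (by linarith) (by linarith) (by linarith)
    have hle := hmin _ _ ht'
    have u1 := hup k (t k) (t k + (1 - θ) / 2 * D) (by linarith)
    have u2 := hup (k + 1) (t k + (1 - θ) / 2 * D) (t (k + 1) - (1 - θ) / 2 * D) (by linarith)
    have u3 := hup k (t (k + 1) - (1 - θ) / 2 * D) (t (k + 1)) (by linarith)
    rw [show t k + (1 - θ) / 2 * D - t k = (1 - θ) / 2 * D by ring] at u1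
    rw [show t (k + 1) - (1 - θ) / 2 * D - (t k + (1 - θ) / 2 * D) = θ * D by
      rw [hDdef]; ring] at u2
    rw [show t (k + 1) - (t (k + 1) - (1 - θ) / 2 * D) = (1 - θ) / 2 * D by ring] at u3
    have l1 := hlo k (t k) (t (k + 1)) (ht.gap k hk)
    have hs := cubic_split_le hc₀ hC hθ hε (hc k).1 (hc (k + 1)).2 hD0.le
    have h3 : c₀ / 2 * D ^ 3 ≤ 2 * μ := by linarith
    rw [hμ, hcθ] at h3
    have h6 : θ * D ^ 3 ≤ (P * τ) ^ 3 := by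
      have : C * (θ * D ^ 3) ≤ C * (P * τ) ^ 3 := by linarith
      exact le_of_mul_le_mul_left this hC0
    have h4 : P * τ < θ * D := by
      have h := mul_lt_mul_of_pos_left hD hθ0
      rwa [← mul_assoc, mul_div_cancel₀ _ hθ0.ne'] at h
    have h5 : (P * τ) ^ 3 < (θ * D) ^ 3 := pow_lt_pow_left₀ h4 (by positivity) (by norm_num)
    have h7 : θ ^ 3 * D ^ 3 ≤ θ * D ^ 3 := by
      refine mul_le_mul_of_nonneg_right ?_ (by positivity)
      exact pow_le_of_le_one hθ0.le (by linarith) (by norm_num)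
    rw [mul_pow θ] at h5
    linarith
  have hgap' : 0 < P / θ * τ := by positivity
  have hΛgap : ∀ k < n, t (k + 1) - t k ≤ Λ * τ := fun k hk => by
    rw [hΛdef]; linarith [hgap k hk]
  -- three consecutive gaps cannot be small
  have htriple : ∀ k, k + 2 < n → P * τ ≤ t (k + 3) - t k := by
    intro k hk
    obtain ⟨t', ht', hcost⟩ := ht.exists_remove (μ := μ) hτ.le hf hk
    have hle := hmin _ _ ht'
    have g0 := ht.gap k (by omega)
    have g1 : τ ≤ t (k + 2) - t (k + 1) := ht.gap (k + 1) (by omega)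
    have g2 : τ ≤ t (k + 3) - t (k + 2) := ht.gap (k + 2) (by omega)
    have u := hup k (t k) (t (k + 3)) (by linarith)
    have n0 := hnn k _ _ g0
    have n1 := hnn (k + 1) _ _ g1
    have n2 := hnn (k + 2) _ _ g2
    have h1 : 2 * μ ≤ (c k + ε) * (t (k + 3) - t k) ^ 3 := by linarith
    have hQ : 0 < t (k + 3) - t k := by linarith
    have h2 : (c k + ε) * (t (k + 3) - t k) ^ 3 ≤ (2 * C) * (t (k + 3) - t k) ^ 3 := by
      refine mul_le_mul_of_nonneg_right ?_ (by positivity)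
      linarith [(hc k).2]
    have h3 : C * (P * τ) ^ 3 ≤ C * (t (k + 3) - t k) ^ 3 := by rw [hμ] at h1; linarith
    exact le_of_pow_le_pow_left₀ (by norm_num) hQ.le (le_of_mul_le_mul_left h3 hC0)
  -- neighbouring gaps are comparable
  have hadj : ∀ k, k + 1 < n → t (k + 2) - t (k + 1) ≤ B * (t (k + 1) - t k) ∧
      t (k + 1) - t k ≤ B * (t (k + 2) - t (k + 1)) := by
    intro k hk
    have g0 := ht.gap k (by omega)
    have g1 : τ ≤ t (k + 2) - t (k + 1) := ht.gap (k + 1) (by omega)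
    set x := t (k + 1) - t k with hx
    set y := t (k + 2) - t (k + 1) with hy
    have hxy : x + y = t (k + 2) - t k := by rw [hx, hy]; ring
    constructor
    · by_contra! hlt
      obtain ⟨h1, -, h2⟩ := hcut (x + y) (by linarith [hBτ x g0])
      obtain ⟨ht', hcost⟩ := ht.move (f := f) (μ := μ) hk (s := t k + θ * (x + y)) (by linarith)
        (by linarith)
      have hle := hmin _ _ ht'
      have u1 := hup k (t k) (t k + θ * (x + y)) (by linarith)
      have u2 := hup (k + 1) (t k + θ * (x + y)) (t (k + 2)) (by linarith)
      rw [add_sub_cancel_left] at u1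
      rw [show t (k + 2) - (t k + θ * (x + y)) = (1 - θ) * (x + y) by rw [hxy]; ring] at u2
      have l1 := hnn k _ _ g0
      have l2 := hlo (k + 1) _ _ g1
      have := cubic_rebalance_lt hc₀ hC hθ hε (hc k) (hc (k + 1)) (by linarith : 0 < x)
        (by rwa [← hB])
      linarith
    · by_contra! hlt
      obtain ⟨h1, -, h2⟩ := hcut (y + x) (by linarith [hBτ y g1])
      obtain ⟨ht', hcost⟩ := ht.move (f := f) (μ := μ) hk (s := t (k + 2) - θ * (y + x))
        (by linarith) (by linarith)
      have hle := hmin _ _ ht'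
      have u1 := hup k (t k) (t (k + 2) - θ * (y + x)) (by linarith)
      have u2 := hup (k + 1) (t (k + 2) - θ * (y + x)) (t (k + 2)) (by linarith)
      rw [sub_sub_cancel] at u2
      rw [show t (k + 2) - θ * (y + x) - t k = (1 - θ) * (y + x) by
        rw [add_comm y x, hxy]; ring] at u1
      have l1 := hlo k _ _ g0
      have l2 := hnn (k + 1) _ _ g1
      have := cubic_rebalance_lt hc₀ hC hθ hε (hc (k + 1)) (hc k) (by linarith : 0 < y)
        (by rwa [← hB])
      linarith
  have hn3 : 3 ≤ n := by
    have hsum := Finset.sum_le_sum (s := Finset.range n) (f := fun i => t (i + 1) - t i)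
      (g := fun _ => P / θ * τ) fun i hi => hgap i (Finset.mem_range.mp hi)
    rw [Finset.sum_range_sub, ht.left, ht.right] at hsum
    simp only [Finset.sum_const, Finset.card_range, nsmul_eq_mul] at hsum
    by_contra! hlt
    have hn : (n : ℝ) ≤ 2 := by exact_mod_cast Nat.lt_succ_iff.mp hlt
    have := mul_le_mul_of_nonneg_right hn hgap'.le
    rw [hΛdef] at hab
    linarith
  -- lower bound for the gaps
  have hlow : ∀ k < n, τ < t (k + 1) - t k := by
    intro k hk
    have key : ∀ j, j + 2 < n → ∀ D, t (j + 1) - t j ≤ B ^ 2 * D →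
        t (j + 2) - t (j + 1) ≤ B ^ 2 * D → t (j + 3) - t (j + 2) ≤ B ^ 2 * D → τ < D := by
      intro j hj D h1 h2 h3
      have h4 := htriple j hj
      have h5 : 4 * B ^ 2 * τ ≤ 3 * B ^ 2 * D := by rw [hP] at h4; linarith
      have : 4 * τ ≤ 3 * D := by
        have h6 : B ^ 2 * (4 * τ) ≤ B ^ 2 * (3 * D) := by linarith
        exact le_of_mul_le_mul_left h6 (by positivity)
      linarith
    have hBB : ∀ x, 0 < x → x ≤ B ^ 2 * x ∧ B * x ≤ B ^ 2 * x := fun x hx =>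
      ⟨le_mul_of_one_le_left hx.le (one_le_pow₀ (by linarith)),
        mul_le_mul_of_nonneg_right (by rw [sq]; exact le_mul_of_one_le_left hB0.le (by linarith))
          hx.le⟩
    have hB2 : ∀ x y, x ≤ B * y → B * x ≤ B ^ 2 * y := fun x y h => by
      have := mul_le_mul_of_nonneg_left h hB0.le
      rwa [← mul_assoc, ← sq] at this
    have hpos : 0 < t (k + 1) - t k := hτ.trans_le (ht.gap k hk)
    have hb := hBB _ hpos
    -- The gap is taken as the first, the middle or the last of a triple, whichever fits in the
    -- subdivision; the others are at most two steps away, hence the factor `B ^ 2`.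
    rcases Nat.lt_or_ge (k + 2) n with h | h
    · have a1 := (hadj k (by omega)).1
      have a2 : t (k + 3) - t (k + 2) ≤ B * (t (k + 2) - t (k + 1)) := (hadj (k + 1) (by omega)).1
      refine key k h _ hb.1 (a1.trans hb.2) (a2.trans (hB2 _ _ a1))
    · obtain ⟨j, rfl⟩ : ∃ j, k = j + 1 := ⟨k - 1, by omega⟩
      have a1 := (hadj j (by omega)).2
      rcases Nat.lt_or_ge (j + 2) n with h' | h'
      · have a2 : t (j + 3) - t (j + 2) ≤ B * (t (j + 2) - t (j + 1)) :=
          (hadj (j + 1) (by omega)).1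
        exact key j h' _ (a1.trans hb.2) hb.1 (a2.trans hb.2)
      · obtain ⟨i, rfl⟩ : ∃ i, j = i + 1 := ⟨j - 1, by omega⟩
        have a2 := (hadj i (by omega)).2
        refine key i (by omega) _ (a2.trans (hB2 _ _ a1)) (a1.trans hb.2) hb.1
  refine ⟨n, t, ht.left, ht.right, fun k hk => ⟨hlow k hk, hΛgap k hk⟩, fun k hk => ?_⟩
  have g0 := hlow k (by omega)
  have g1 : τ < t (k + 2) - t (k + 1) := hlow (k + 1) hk
  -- Both adjacent gaps exceed `τ` strictly, so every nearby position of the node is an admissible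
  -- competitor: the minimum is an unconstrained local one.
  have hnhds : Ioo (t k + τ) (t (k + 2) - τ) ∈ 𝓝 (t (k + 1)) :=
    Ioo_mem_nhds (by linarith) (by linarith)
  filter_upwards [hnhds] with s hs
  obtain ⟨ht', hcost⟩ := ht.move (f := f) (μ := μ) hk (s := s) (by linarith [hs.1])
    (by linarith [hs.2])
  have hle := hmin _ _ ht'
  linarith

/-! ### Second order equations with bounded Lipschitz right-hand side -/

/-- `u`, with derivative `u'`, solves `ü = F(t, u)` on the whole line. -/
def IsSecondOrderSol (F : ℝ → ℝ → ℝ) (u u' : ℝ → ℝ) : Prop :=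
  ∀ t, HasDerivAt u (u' t) t ∧ HasDerivAt u' (F t (u t)) t

namespace IsSecondOrderSol

/-- The first order system attached to `ü = F(t, u)`. -/
def field (F : ℝ → ℝ → ℝ) (t : ℝ) (z : ℝ × ℝ) : ℝ × ℝ := (z.2, F t z.1)

lemma lipschitz_field {F : ℝ → ℝ → ℝ} {K : NNReal} (hL : ∀ t, LipschitzWith K (F t)) (t : ℝ) :
    LipschitzWith (max 1 K) (field F t) := by
  have h1 : LipschitzWith 1 (fun z : ℝ × ℝ => z.2) := LipschitzWith.prod_snd
  have h2 : LipschitzWith (K * 1) (fun z : ℝ × ℝ => F t z.1) := (hL t).comp LipschitzWith.prod_fst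
  rw [mul_one] at h2
  exact h1.prodMk h2

/-- Picard–Lindelöf on an interval of prescribed length needs a bounded field, while the component
`z.2` is unbounded. It is truncated at `|v| + C * R`, a level which the velocity cannot exceed
because `|F| ≤ C`. -/
lemma exists_on_Icc {F : ℝ → ℝ → ℝ} {K : NNReal} {C : ℝ} (hc : ∀ x, Continuous fun t => F t x)
    (hL : ∀ t, LipschitzWith K (F t)) (hC : ∀ t x, |F t x| ≤ C) (t₀ x v : ℝ) {R : ℝ} (hR : 0 < R) :
    ∃ z : ℝ → ℝ × ℝ, z t₀ = (x, v) ∧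
      ∀ t ∈ Icc (t₀ - R) (t₀ + R), HasDerivWithinAt z (field F t (z t)) (Icc (t₀ - R) (t₀ + R)) t := by
  have hC0 : 0 ≤ C := (abs_nonneg _).trans (hC 0 0)
  set M : ℝ := |v| + C * R with hM
  have hM0 : 0 ≤ M := by positivity
  set f : ℝ → ℝ × ℝ → ℝ × ℝ := fun t z => (max (-M) (min z.2 M), F t z.1) with hf
  have hmem : t₀ ∈ Icc (t₀ - R) (t₀ + R) := ⟨by linarith, by linarith⟩
  have hPL : IsPicardLindelof f (⟨t₀, hmem⟩ : Icc (t₀ - R) (t₀ + R)) (x, v)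
      ((max M C).toNNReal * R.toNNReal) 0 (max M C).toNNReal (max 1 K) := by
    refine ⟨fun t _ => LipschitzWith.lipschitzOnWith ?_, fun z _ => ?_, fun t _ z _ => ?_, ?_⟩
    · have h1 : LipschitzWith 1 (fun z : ℝ × ℝ => max (-M) (min z.2 M)) :=
        (LipschitzWith.prod_snd.min_const M).const_max (-M)
      have h2 : LipschitzWith (K * 1) (fun z : ℝ × ℝ => F t z.1) :=
        (hL t).comp LipschitzWith.prod_fst
      rw [mul_one] at h2
      exact h1.prodMk h2
    · exact (continuous_const.prodMk (hc _)).continuousOn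
    · rw [Real.coe_toNNReal _ (le_max_of_le_left hM0)]
      refine norm_prod_le_iff.mpr ⟨?_, ?_⟩
      · refine le_max_of_le_left (abs_le.mpr ⟨le_max_left _ _, max_le (by linarith) (min_le_right _ _)⟩)
      · exact le_max_of_le_right (hC _ _)
    · simp [hR.le]
  obtain ⟨z, hz0, hz⟩ := hPL.exists_eq_forall_mem_Icc_hasDerivWithinAt₀
  refine ⟨z, hz0, fun t ht => ?_⟩
  have hz2 : ∀ s ∈ Icc (t₀ - R) (t₀ + R),
      HasDerivWithinAt (fun s => (z s).2) (F s (z s).1) (Icc (t₀ - R) (t₀ + R)) s := fun s hs =>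
    (hasFDerivAt_snd (𝕜 := ℝ) (p := z s)).comp_hasDerivWithinAt s (hz s hs)
  have hbd := (convex_Icc (t₀ - R) (t₀ + R)).norm_image_sub_le_of_norm_hasDerivWithin_le
    hz2 (fun s _ => hC s _) hmem ht
  simp only [hz0, Real.norm_eq_abs] at hbd
  have hle : |t - t₀| ≤ R := abs_le.mpr ⟨by linarith [ht.1], by linarith [ht.2]⟩
  have h2 : |(z t).2| ≤ M := by
    have := abs_sub_abs_le_abs_sub (z t).2 v
    have := mul_le_mul_of_nonneg_left hle hC0
    linarith
  have h3 := abs_le.mp h2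
  have := hz t ht
  simp only [hf] at this
  rwa [min_eq_left h3.2, max_eq_right h3.1] at this

/-- A bounded right-hand side which is Lipschitz in `u` has global solutions. -/
theorem exists_global {F : ℝ → ℝ → ℝ} {K : NNReal} {C : ℝ} (hc : ∀ x, Continuous fun t => F t x)
    (hL : ∀ t, LipschitzWith K (F t)) (hC : ∀ t x, |F t x| ≤ C) (t₀ x v : ℝ) :
    ∃ u u' : ℝ → ℝ, IsSecondOrderSol F u u' ∧ u t₀ = x ∧ u' t₀ = v := by
  choose! Z hZ0 hZ using fun (R : ℝ) (hR : 0 < R) => exists_on_Icc hc hL hC t₀ x v hR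
  have hZ' : ∀ R, 0 < R → ∀ t ∈ Ioo (t₀ - R) (t₀ + R),
      HasDerivAt (Z R) (field F t (Z R t)) t ∧ Z R t ∈ (univ : Set (ℝ × ℝ)) := fun R hR t ht =>
    ⟨(hZ R hR t (Ioo_subset_Icc_self ht)).hasDerivAt (Icc_mem_nhds ht.1 ht.2), mem_univ _⟩
  have hagree : ∀ R R', 0 < R → R ≤ R' → EqOn (Z R) (Z R') (Ioo (t₀ - R) (t₀ + R)) := by
    intro R R' hR hRR'
    refine ODE_solution_unique_of_mem_Ioo (v := field F) (s := fun _ => univ) (K := max 1 K)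
      (fun t _ => (lipschitz_field hL t).lipschitzOnWith) (t₀ := t₀) ⟨by linarith, by linarith⟩
      (hZ' R hR) (fun t ht => hZ' R' (hR.trans_le hRR') t ⟨by linarith [ht.1], by linarith [ht.2]⟩) ?_
    rw [hZ0 R hR, hZ0 R' (hR.trans_le hRR')]
  -- The radius depends on the point; by uniqueness it may be replaced near `t` by the fixed radius
  -- `|t - t₀| + 2`, which makes `z` differentiable.
  set z : ℝ → ℝ × ℝ := fun t => Z (|t - t₀| + 1) t with hz
  have key : ∀ t, HasDerivAt z (field F t (z t)) t := by
    intro t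
    have hpos : 0 < |t - t₀| + 2 := by positivity
    have hloc : ∀ s, |s - t| < 1 → z s = Z (|t - t₀| + 2) s := by
      intro s hs
      have h1 : |s - t₀| ≤ |s - t| + |t - t₀| := abs_sub_le s t t₀
      refine hagree _ _ (by positivity) (by linarith) ⟨?_, ?_⟩
      · linarith [neg_abs_le (s - t₀)]
      · linarith [le_abs_self (s - t₀)]
    have hev : z =ᶠ[𝓝 t] Z (|t - t₀| + 2) := by
      filter_upwards [Metric.ball_mem_nhds t one_pos] with s hs
      exact hloc s (by simpa [Real.dist_eq] using hs)
    rw [hloc t (by simp)]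
    refine HasDerivAt.congr_of_eventuallyEq (hZ' _ hpos t ⟨?_, ?_⟩).1 hev
    · linarith [neg_abs_le (t - t₀)]
    · linarith [le_abs_self (t - t₀)]
  refine ⟨fun t => (z t).1, fun t => (z t).2, fun t => ⟨?_, ?_⟩, ?_, ?_⟩
  · exact (hasFDerivAt_fst (𝕜 := ℝ) (p := z t)).comp_hasDerivAt t (key t)
  · exact (hasFDerivAt_snd (𝕜 := ℝ) (p := z t)).comp_hasDerivAt t (key t)
  · simp [hz, hZ0]
  · simp [hz, hZ0]

variable {F : ℝ → ℝ → ℝ} {u u' w w' : ℝ → ℝ}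

lemma hasDerivAt_pair (h : IsSecondOrderSol F u u') (t : ℝ) :
    HasDerivAt (fun t => (u t, u' t)) (field F t (u t, u' t)) t :=
  (h t).1.prodMk (h t).2

lemma continuous (h : IsSecondOrderSol F u u') : Continuous u :=
  continuous_iff_continuousAt.mpr fun t => (h t).1.continuousAt

lemma continuous_deriv (h : IsSecondOrderSol F u u') : Continuous u' :=
  continuous_iff_continuousAt.mpr fun t => (h t).2.continuousAt

/-- Time reversal, which turns forward Grönwall estimates into backward ones. -/
lemma comp_neg (h : IsSecondOrderSol F u u') :
    IsSecondOrderSol (fun t x => F (-t) x) (fun t => u (-t)) (fun t => -u' (-t)) := by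
  intro t
  constructor
  · have := (h (-t)).1.comp t (hasDerivAt_neg t)
    rwa [mul_neg_one] at this
  · have := ((h (-t)).2.comp t (hasDerivAt_neg t)).neg
    rw [mul_neg_one, neg_neg] at this
    exact this

lemma dist_le_right {K : NNReal} (hL : ∀ t, LipschitzWith K (F t)) (hu : IsSecondOrderSol F u u')
    (hw : IsSecondOrderSol F w w') {t₀ t δ : ℝ} (ht : t₀ ≤ t) (h0 : |u t₀ - w t₀| ≤ δ)
    (h1 : |u' t₀ - w' t₀| ≤ δ) :
    |u t - w t| ≤ δ * Real.exp (max 1 K * (t - t₀)) ∧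
      |u' t - w' t| ≤ δ * Real.exp (max 1 K * (t - t₀)) := by
  have := dist_le_of_trajectories_ODE (v := field F) (K := max 1 K) (a := t₀) (b := t) (δ := δ)
    (lipschitz_field hL)
    (fun s _ => (hu.hasDerivAt_pair s).continuousAt.continuousWithinAt)
    (fun s _ => (hu.hasDerivAt_pair s).hasDerivWithinAt)
    (fun s _ => (hw.hasDerivAt_pair s).continuousAt.continuousWithinAt)
    (fun s _ => (hw.hasDerivAt_pair s).hasDerivWithinAt)
    (by rw [Prod.dist_eq]; exact max_le h0 h1) t ⟨ht, le_rfl⟩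
  rw [Prod.dist_eq] at this
  simpa [Real.dist_eq] using this

/-- Continuous dependence on the initial data. -/
theorem dist_le {K : NNReal} (hL : ∀ t, LipschitzWith K (F t)) (hu : IsSecondOrderSol F u u')
    (hw : IsSecondOrderSol F w w') {t₀ δ : ℝ} (h0 : |u t₀ - w t₀| ≤ δ)
    (h1 : |u' t₀ - w' t₀| ≤ δ) (t : ℝ) :
    |u t - w t| ≤ δ * Real.exp (max 1 K * |t - t₀|) ∧
      |u' t - w' t| ≤ δ * Real.exp (max 1 K * |t - t₀|) := by
  rcases le_total t₀ t with ht | ht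
  · rw [abs_of_nonneg (sub_nonneg.mpr ht)]
    exact dist_le_right hL hu hw ht h0 h1
  · have := dist_le_right (fun t => hL (-t)) hu.comp_neg hw.comp_neg (t₀ := -t₀) (t := -t) (δ := δ)
      (by linarith) (by simpa using h0)
      (by rw [neg_neg, neg_sub_neg, abs_sub_comm]; exact h1)
    simp only [neg_neg] at this
    rw [abs_of_nonpos (sub_nonpos.mpr ht)]
    rw [neg_sub_neg, neg_sub_neg, abs_sub_comm (w' t)] at this
    rwa [neg_sub]

theorem eq_of_eq {K : NNReal} (hL : ∀ t, LipschitzWith K (F t)) (hu : IsSecondOrderSol F u u')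
    (hw : IsSecondOrderSol F w w') {t₀ : ℝ} (h0 : u t₀ = w t₀) (h1 : u' t₀ = w' t₀) :
    u = w ∧ u' = w' := by
  have h := fun t => dist_le hL hu hw (t₀ := t₀) (δ := 0) (by simp [h0]) (by simp [h1]) t
  constructor <;> funext t
  · have := (h t).1
    rw [zero_mul, abs_nonpos_iff] at this; linarith
  · have := (h t).2
    rw [zero_mul, abs_nonpos_iff] at this; linarith

/-- The truncated equation and the original one share the solutions on an interval where the
two right-hand sides agree along one of them. -/
theorem eqOn_of_agree {G : ℝ → ℝ → ℝ} {K : NNReal} (hL : ∀ t, LipschitzWith K (G t))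
    (hu : IsSecondOrderSol F u u') (hw : IsSecondOrderSol G w w') {a b : ℝ}
    (h0 : u a = w a) (h1 : u' a = w' a) (hFG : ∀ t ∈ Icc a b, F t (u t) = G t (u t)) :
    ∀ t ∈ Icc a b, u t = w t ∧ u' t = w' t := by
  have := ODE_solution_unique (v := field G) (K := max 1 K) (a := a) (b := b)
    (f := fun t => (u t, u' t)) (g := fun t => (w t, w' t))
    (lipschitz_field hL)
    (fun s _ => (hu.hasDerivAt_pair s).continuousAt.continuousWithinAt)
    (fun s hs => by
      have := (hu.hasDerivAt_pair s).hasDerivWithinAt (s := Ici s)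
      have e : field F s (u s, u' s) = field G s (u s, u' s) := by
        simp [field, hFG s (Ico_subset_Icc_self hs)]
      rwa [e] at this)
    (fun s _ => (hw.hasDerivAt_pair s).continuousAt.continuousWithinAt)
    (fun s _ => (hw.hasDerivAt_pair s).hasDerivWithinAt)
    (by simp [h0, h1])
  intro t ht
  simpa using this ht

end IsSecondOrderSol

/-! ### The normalised equation and its positive arcs -/

/-- The normalised equation `ü + g(u) = p(t)`: `g` is bounded, increasing, concave on `[0, ∞)`,
with limit `α > 0` at `+∞`, and `p` is bounded with asymptotic average `0`. -/
structure IsNormalized (g g' p : ℝ → ℝ) (M α : ℝ) (K : NNReal) : Prop where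
  hasDerivAt : ∀ x, HasDerivAt g (g' x) x
  mono : Monotone g
  lip : LipschitzWith K g
  bdd : ∀ x, |g x| ≤ M
  anti : AntitoneOn g' (Ici 0)
  deriv_pos : ∀ x, 0 ≤ x → 0 < g' x
  lim : Tendsto g atTop (𝓝 α)
  pos : 0 < α
  p_cont : Continuous p
  p_bdd : ∀ t, |p t| ≤ M
  avg : ∀ ε > 0, ∃ S > 0, ∀ t T, S ≤ T → |∫ s in t..t + T, p s| ≤ ε * T

/-- A solution of `ü + g(u) = p(t)` vanishing at `a` and `b` and close, on `[a, b]`, to the parabola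
with second derivative `-α`. -/
structure IsArc (g p : ℝ → ℝ) (α η a b : ℝ) (u u' : ℝ → ℝ) : Prop where
  sol : IsSecondOrderSol (fun t x => p t - g x) u u'
  left : u a = 0
  right : u b = 0
  deriv_le : ∀ s ∈ Icc a b, |u' s - α * ((a + b) / 2 - s)| ≤ η * (b - a)

lemma mul_sub_ge_min {a b s : ℝ} (hs : s ∈ Icc a b) :
    (b - a) / 2 * min (s - a) (b - s) ≤ (s - a) * (b - s) := by
  have h1 := hs.1
  have h2 := hs.2
  rcases le_total (s - a) (b - s) with h | h
  · rw [min_eq_left h]; nlinarith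
  · rw [min_eq_right h]; nlinarith

/-- The velocity estimate is integrated from the nearer endpoint. -/
lemma abs_sub_parabola_le {u u' : ℝ → ℝ} {α η a b : ℝ} (hu : ∀ t, HasDerivAt u (u' t) t)
    (ha : u a = 0) (hb : u b = 0)
    (hle : ∀ s ∈ Icc a b, |u' s - α * ((a + b) / 2 - s)| ≤ η * (b - a)) {s : ℝ} (hs : s ∈ Icc a b) :
    |u s - α / 2 * ((s - a) * (b - s))| ≤ η * (b - a) * min (s - a) (b - s) := by
  have hd : ∀ t ∈ Icc a b, HasDerivWithinAt (fun t => u t - α / 2 * ((t - a) * (b - t)))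
      (u' t - α * ((a + b) / 2 - t)) (Icc a b) t := by
    intro t _
    have h2 : HasDerivAt (fun t => α / 2 * ((t - a) * (b - t)))
        (α / 2 * (1 * (b - t) + (t - a) * (0 - 1))) t :=
      ((((hasDerivAt_id t).sub_const a).mul ((hasDerivAt_const t b).sub (hasDerivAt_id t))).const_mul
        (α / 2))
    refine (((hu t).sub h2).congr_deriv ?_).hasDerivWithinAt
    ring
  have hab : a ≤ b := hs.1.trans hs.2
  have key := fun x (hx : x ∈ Icc a b) =>
    (convex_Icc a b).norm_image_sub_le_of_norm_hasDerivWithin_le hd hle hx hs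
  have k1 := key a ⟨le_rfl, hab⟩
  have k2 := key b ⟨hab, le_rfl⟩
  simp only [Real.norm_eq_abs, ha, hb, sub_self, zero_mul, mul_zero, sub_zero] at k1 k2
  rw [abs_of_nonneg (sub_nonneg.mpr hs.1)] at k1
  rw [abs_of_nonpos (sub_nonpos.mpr hs.2), neg_sub] at k2
  rcases le_total (s - a) (b - s) with h | h
  · rwa [min_eq_left h]
  · rwa [min_eq_right h]

/-- The parabola is at least twice the tent on the left-hand side, and an error with `η ≤ α / 8`
uses up at most half of it. This tent bound serves both to remove the truncation when arcs are
constructed and to control the linearised equation. -/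
lemma parabola_lower {u u' : ℝ → ℝ} {α η a b : ℝ} (hu : ∀ t, HasDerivAt u (u' t) t)
    (ha : u a = 0) (hb : u b = 0)
    (hle : ∀ s ∈ Icc a b, |u' s - α * ((a + b) / 2 - s)| ≤ η * (b - a)) (hα : 0 < α)
    (hη : η ≤ α / 8) {s : ℝ} (hs : s ∈ Icc a b) :
    α / 8 * (b - a) * min (s - a) (b - s) ≤ u s := by
  have h1 := (abs_le.mp (abs_sub_parabola_le hu ha hb hle hs)).1
  have h2 := mul_sub_ge_min hs
  have h3 : 0 ≤ min (s - a) (b - s) := le_min (sub_nonneg.mpr hs.1) (sub_nonneg.mpr hs.2)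
  have h4 : 0 ≤ b - a := by linarith [hs.1, hs.2]
  have h5 : η * (b - a) * min (s - a) (b - s) ≤ α / 8 * (b - a) * min (s - a) (b - s) := by gcongr
  have h6 := mul_le_mul_of_nonneg_left h2 (by positivity : 0 ≤ α / 2)
  linarith

lemma LipschitzWith.const_sub_real {K : NNReal} {f : ℝ → ℝ} (hf : LipschitzWith K f) (c : ℝ) :
    LipschitzWith K fun x => c - f x :=
  LipschitzWith.of_dist_le_mul fun x y => by rw [dist_sub_left]; exact hf.dist_le_mul x y

namespace IsNormalized

variable {g g' p : ℝ → ℝ} {M α : ℝ} {K : NNReal}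

lemma continuous (h : IsNormalized g g' p M α K) : Continuous g := h.lip.continuous

lemma le_lim (h : IsNormalized g g' p M α K) (x : ℝ) : g x ≤ α := h.mono.ge_of_tendsto h.lim x

lemma lim_le (h : IsNormalized g g' p M α K) : α ≤ M :=
  le_of_tendsto' h.lim fun x => (abs_le.mp (h.bdd x)).2

lemma bound_pos (h : IsNormalized g g' p M α K) : 0 < M := h.pos.trans_le h.lim_le

lemma deficit_le (h : IsNormalized g g' p M α K) (x : ℝ) : α - g x ≤ 2 * M := by
  linarith [h.lim_le, (abs_le.mp (h.bdd x)).1]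

lemma exists_deficit_le (h : IsNormalized g g' p M α K) {ε : ℝ} (hε : 0 < ε) :
    ∃ R > 0, ∀ x, R ≤ x → α - g x ≤ ε := by
  have := h.lim.eventually (lt_mem_nhds (show α - ε < α by linarith))
  obtain ⟨R, hR⟩ := eventually_atTop.mp this
  refine ⟨max R 1, by positivity, fun x hx => ?_⟩
  linarith [hR x (le_of_max_le_left hx)]

/-- Windows of length at least `S` are handled by the uniform mean; on shorter ones the trivial
bound `M * S` is already below `ε * T` for large `T`. -/
lemma exists_integral_p_le (h : IsNormalized g g' p M α K) {ε : ℝ} (hε : 0 < ε) :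
    ∃ τ > 0, ∀ T, τ ≤ T → ∀ s t, |t - s| ≤ T → |∫ x in s..t, p x| ≤ ε * T := by
  obtain ⟨S, hS, hav⟩ := h.avg ε hε
  have hM := h.bound_pos
  refine ⟨max S (M * S / ε), lt_max_of_lt_left hS, fun T hT => ?_⟩
  have key : ∀ s t, s ≤ t → t - s ≤ T → |∫ x in s..t, p x| ≤ ε * T := by
    intro s t hst hle
    rcases le_total S (t - s) with h1 | h1
    · have := hav s (t - s) h1
      rw [add_sub_cancel] at this
      exact this.trans (mul_le_mul_of_nonneg_left hle hε.le)
    · have := intervalIntegral.norm_integral_le_of_norm_le_const (a := s) (b := t) (f := p) (C := M)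
        fun x _ => h.p_bdd x
      rw [Real.norm_eq_abs, abs_of_nonneg (sub_nonneg.mpr hst)] at this
      have h2 := (le_max_right S _).trans hT
      rw [div_le_iff₀ hε] at h2
      have h3 := mul_le_mul_of_nonneg_left h1 hM.le
      linarith
  intro s t hst
  rcases le_total s t with h1 | h1
  · exact key s t h1 ((le_abs_self _).trans hst)
  · rw [intervalIntegral.integral_symm, abs_neg]
    exact key t s h1 (by rw [abs_sub_comm] at hst; exact (le_abs_self _).trans hst)

/-- The argument of `g` grows with slope `κ * T`, so for large `T` it is beyond any given level once
`r ≥ 1`. The part over `[0, 1]` contributes at most `2 * M`. -/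
lemma exists_integral_deficit_le (h : IsNormalized g g' p M α K) {κ ε : ℝ} (hκ : 0 < κ)
    (hε : 0 < ε) :
    ∃ τ > 0, ∀ T, τ ≤ T → ∫ r in (0 : ℝ)..T, (α - g (κ * T * r)) ≤ ε * T := by
  obtain ⟨R, hR, hRg⟩ := h.exists_deficit_le (half_pos hε)
  have hM := h.bound_pos
  refine ⟨max 1 (max (R / κ) (4 * M / ε)), by positivity, fun T hT => ?_⟩
  have h1 : 1 ≤ T := (le_max_left _ _).trans hT
  have h2 : R / κ ≤ T := (le_max_left _ _).trans ((le_max_right _ _).trans hT)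
  have h3 : 4 * M / ε ≤ T := (le_max_right _ _).trans ((le_max_right _ _).trans hT)
  rw [div_le_iff₀ hκ] at h2
  rw [div_le_iff₀ hε] at h3
  have hcont : Continuous fun r => α - g (κ * T * r) :=
    continuous_const.sub (h.continuous.comp (by fun_prop))
  have hint := fun x y => hcont.intervalIntegrable (μ := MeasureTheory.volume) x y
  rw [← intervalIntegral.integral_add_adjacent_intervals (hint 0 1) (hint 1 T)]
  have i1 : ∫ r in (0 : ℝ)..1, (α - g (κ * T * r)) ≤ ∫ r in (0 : ℝ)..1, 2 * M :=
    intervalIntegral.integral_mono_on zero_le_one (hint _ _) (by simp) fun x _ => h.deficit_le _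
  have i2 : ∫ r in (1 : ℝ)..T, (α - g (κ * T * r)) ≤ ∫ r in (1 : ℝ)..T, ε / 2 :=
    intervalIntegral.integral_mono_on h1 (hint _ _) (by simp) fun x hx => hRg _ (by
      have : κ * T * 1 ≤ κ * T * x := mul_le_mul_of_nonneg_left hx.1 (by positivity)
      linarith)
  simp only [intervalIntegral.integral_const, smul_eq_mul] at i1 i2
  linarith

/-- The truncated nonlinearity deviates from its limit by little on average. -/
lemma exists_integral_min_deficit_le (h : IsNormalized g g' p M α K) {κ ε : ℝ} (hκ : 0 < κ)
    (hε : 0 < ε) :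
    ∃ τ > 0, ∀ a b, τ ≤ b - a → ∀ (v : ℝ → ℝ), Continuous v → ∀ t ∈ Icc a b,
      |∫ s in a..t, (α - g (max (v s) (κ * (b - a) * min (s - a) (b - s))))| ≤ ε * (b - a) := by
  obtain ⟨τ, hτ, hd⟩ := h.exists_integral_deficit_le hκ (half_pos hε)
  refine ⟨τ, hτ, fun a b hab v hv t ht => ?_⟩
  have hT : 0 < b - a := hτ.trans_le hab
  have hg := h.continuous
  set T := b - a with hTdef
  have hnn : ∀ x, 0 ≤ α - g x := fun x => sub_nonneg.mpr (h.le_lim x)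
  have c1 : Continuous fun s => α - g (max (v s) (κ * T * min (s - a) (b - s))) := by fun_prop
  have c2 : Continuous fun s => α - g (κ * T * (s - a)) := by fun_prop
  have c3 : Continuous fun s => α - g (κ * T * (b - s)) := by fun_prop
  rw [abs_of_nonneg (intervalIntegral.integral_nonneg ht.1 fun s _ => hnn _)]
  have hab' : a ≤ b := ht.1.trans ht.2
  calc ∫ s in a..t, (α - g (max (v s) (κ * T * min (s - a) (b - s))))
      ≤ ∫ s in a..b, (α - g (max (v s) (κ * T * min (s - a) (b - s)))) := by
        rw [← intervalIntegral.integral_add_adjacent_intervals (c1.intervalIntegrable a t)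
          (c1.intervalIntegrable t b)]
        linarith [intervalIntegral.integral_nonneg (μ := MeasureTheory.volume) ht.2
          fun s _ => hnn (max (v s) (κ * T * min (s - a) (b - s)))]
    _ ≤ ∫ s in a..b, ((α - g (κ * T * (s - a))) + (α - g (κ * T * (b - s)))) := by
        refine intervalIntegral.integral_mono_on hab' (c1.intervalIntegrable _ _)
          ((c2.add c3).intervalIntegrable _ _) fun s _ => ?_
        -- By monotonicity `v` may be dropped; the tent equals one of two linear functions at each
        -- point, so its deficit is at most the sum of theirs.
        have h1 := h.mono (le_max_right (v s) (κ * T * min (s - a) (b - s)))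
        have h2 := hnn (κ * T * (s - a))
        have h3 := hnn (κ * T * (b - s))
        rcases le_total (s - a) (b - s) with h4 | h4
        · rw [min_eq_left h4] at h1 ⊢; linarith
        · rw [min_eq_right h4] at h1 ⊢; linarith
    _ = (∫ s in (0 : ℝ)..T, (α - g (κ * T * s))) + ∫ s in (0 : ℝ)..T, (α - g (κ * T * s)) := by
        rw [intervalIntegral.integral_add (c2.intervalIntegrable _ _) (c3.intervalIntegrable _ _)]
        congr 1
        · rw [intervalIntegral.integral_comp_sub_right (fun s => α - g (κ * T * s)) a, sub_self]
        · rw [intervalIntegral.integral_comp_sub_left (fun s => α - g (κ * T * s)) b, sub_self]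
    _ ≤ ε * T := by linarith [hd T hab]

/-- On every long interval there is an arc close to the parabola. -/
theorem exists_arc (h : IsNormalized g g' p M α K) {η : ℝ} (hη : 0 < η) (hηα : η ≤ α / 8) :
    ∃ τ > 0, ∀ a b, τ ≤ b - a → ∃ u u', IsArc g p α η a b u u' := by
  have hα := h.pos
  have hg := h.continuous
  have hpc := h.p_cont
  obtain ⟨κ, hκ⟩ : ∃ κ, κ = α / 8 := ⟨_, rfl⟩
  have hκ0 : 0 < κ := by rw [hκ]; positivity
  obtain ⟨τ₁, hτ₁, hp⟩ := h.exists_integral_p_le (ε := η / 4) (by positivity)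
  obtain ⟨τ₂, hτ₂, hd⟩ := h.exists_integral_min_deficit_le hκ0 (ε := η / 4) (by positivity)
  refine ⟨max τ₁ τ₂, lt_max_of_lt_left hτ₁, fun a b hab => ?_⟩
  have hT : 0 < b - a := (lt_max_of_lt_left hτ₁).trans_le hab
  have hab' : a ≤ b := by linarith
  -- Shooting from `a`. The nonlinearity is frozen below the tent, so that the force averages to
  -- `-α` for every trajectory, whatever its initial velocity; the tent bound for the trajectory
  -- found later makes the freezing irrelevant.
  obtain ⟨F, hF⟩ : ∃ F : ℝ → ℝ → ℝ, F = fun t x =>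
    p t - g (max x (κ * (b - a) * min (t - a) (b - t))) := ⟨_, rfl⟩
  have hFL : ∀ t, LipschitzWith K (F t) := fun t => by
    have h1 : LipschitzWith 1 fun x : ℝ => max x (κ * (b - a) * min (t - a) (b - t)) :=
      LipschitzWith.id.max_const _
    have h2 := h.lip.comp h1
    rw [mul_one] at h2
    rw [hF]
    exact h2.const_sub_real (p t)
  have hFc : ∀ x, Continuous fun t => F t x := fun x => by rw [hF]; fun_prop
  have hFb : ∀ t x, |F t x| ≤ 2 * M := fun t x => by
    rw [hF]
    exact (abs_sub _ _).trans (by linarith [h.p_bdd t, h.bdd (max x (κ * (b - a) * min (t - a) (b - t)))])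
  choose U U' hU hUa hU'a using fun v => IsSecondOrderSol.exists_global hFc hFL hFb a 0 v
  -- the velocity is nearly affine
  have hvel : ∀ v, ∀ t ∈ Icc a b, |U' v t - (v - α * (t - a))| ≤ η / 2 * (b - a) := by
    intro v t ht
    have c1 : Continuous fun s => α - g (max (U v s) (κ * (b - a) * min (s - a) (b - s))) := by
      have := (hU v).continuous
      fun_prop
    have hc : Continuous fun s => F s (U v s) := by
      have := (hU v).continuous
      rw [hF]; fun_prop
    have h1 := intervalIntegral.integral_eq_sub_of_hasDerivAt (a := a) (b := t)
      (fun s _ => (hU v s).2) (hc.intervalIntegrable _ _)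
    have h2 : ∫ s in a..t, F s (U v s) = (∫ s in a..t, p s) +
        (∫ s in a..t, (α - g (max (U v s) (κ * (b - a) * min (s - a) (b - s))))) - α * (t - a) := by
      have h3 : ∫ _ in a..t, α = α * (t - a) := by
        rw [intervalIntegral.integral_const, smul_eq_mul, mul_comm]
      rw [← h3, ← intervalIntegral.integral_add (hpc.intervalIntegrable _ _)
        (c1.intervalIntegrable _ _), ← intervalIntegral.integral_sub
        (f := fun s => p s + (α - g (max (U v s) (κ * (b - a) * min (s - a) (b - s)))))
        ((hpc.add c1).intervalIntegrable _ _) (continuous_const.intervalIntegrable _ _)]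
      refine intervalIntegral.integral_congr fun s _ => ?_
      simp only [hF]; ring
    have h3 := hp (b - a) ((le_max_left _ _).trans hab) a t (by
      rw [abs_of_nonneg (by linarith [ht.1])]; linarith [ht.2])
    have h4 := hd a b ((le_max_right _ _).trans hab) (U v) (hU v).continuous t ht
    have h5 : U' v t - (v - α * (t - a)) = (∫ s in a..t, p s) +
        (∫ s in a..t, (α - g (max (U v s) (κ * (b - a) * min (s - a) (b - s))))) := by
      have := hU'a v
      linarith
    rw [h5]
    exact (abs_add_le _ _).trans (by linarith)
  have hpos : ∀ v, |U v b - (v * (b - a) - α / 2 * (b - a) ^ 2)| ≤ η / 2 * (b - a) * (b - a) := by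
    intro v
    have hder : ∀ t ∈ Icc a b, HasDerivWithinAt (fun t => U v t - (v * (t - a) - α / 2 * (t - a) ^ 2))
        (U' v t - (v - α * (t - a))) (Icc a b) t := by
      intro t _
      have e1 : HasDerivAt (fun t => v * (t - a) - α / 2 * (t - a) ^ 2)
          (v * 1 - α / 2 * ((2 : ℕ) * (t - a) ^ (2 - 1) * 1)) t :=
        (((hasDerivAt_id t).sub_const a).const_mul v).sub
          ((((hasDerivAt_id t).sub_const a).pow 2).const_mul (α / 2))
      refine (((hU v t).1.sub e1).congr_deriv ?_).hasDerivWithinAt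
      norm_num; ring
    have := (convex_Icc a b).norm_image_sub_le_of_norm_hasDerivWithin_le hder
      (fun t ht => hvel v t ht) (x := a) (y := b) ⟨le_rfl, hab'⟩ ⟨hab', le_rfl⟩
    simpa [Real.norm_eq_abs, hUa, abs_of_pos hT] using this
  have hcont : Continuous fun v => U v b := by
    rw [Metric.continuous_iff]
    intro v ε hε
    refine ⟨ε / Real.exp (max 1 K * |b - a|), by positivity, fun w hw => ?_⟩
    rw [Real.dist_eq] at hw ⊢
    refine ((hU w).dist_le hFL (hU v) (t₀ := a) (δ := |w - v|) (by simp [hUa])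
      (by rw [hU'a, hU'a]) b).1.trans_lt ?_
    rwa [lt_div_iff₀ (by positivity)] at hw
  -- The exact parabola vanishes at `b` for initial velocity `α / 2 * (b - a)`. Changing this by `η
  -- / 2 * (b - a)` either way outweighs the error in `hpos`, so the value at `b` changes sign.
  obtain ⟨v, hv, hv0⟩ : (0 : ℝ) ∈ (fun v => U v b) ''
      Icc (α / 2 * (b - a) - η / 2 * (b - a)) (α / 2 * (b - a) + η / 2 * (b - a)) := by
    refine intermediate_value_Icc (by nlinarith) hcont.continuousOn ⟨?_, ?_⟩
    · have := (abs_le.mp (hpos (α / 2 * (b - a) - η / 2 * (b - a)))).2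
      linarith
    · have := (abs_le.mp (hpos (α / 2 * (b - a) + η / 2 * (b - a)))).1
      linarith
  have hclose : ∀ s ∈ Icc a b, |U' v s - α * ((a + b) / 2 - s)| ≤ η * (b - a) := by
    intro s hs
    have h1 := abs_le.mp (hvel v s hs)
    exact abs_le.mpr ⟨by linarith [hv.1, h1.1], by linarith [hv.2, h1.2]⟩
  obtain ⟨w, w', hw, hwa, hw'a⟩ := IsSecondOrderSol.exists_global (F := fun t x => p t - g x)
    (K := K) (C := 2 * M) (fun x => by fun_prop)
    (fun t => h.lip.const_sub_real (p t))
    (fun t x => (abs_sub _ _).trans (by linarith [h.p_bdd t, h.bdd x])) a 0 v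
  -- Along the trajectory just found `parabola_lower` shows that the maximum in `F` is attained by
  -- the solution itself, so it solves the original equation on `[a, b]`.
  have heq := (hU v).eqOn_of_agree (fun t => h.lip.const_sub_real (p t)) hw (a := a) (b := b)
    (by rw [hUa, hwa]) (by rw [hU'a, hw'a]) fun t ht => by
      have hlow := parabola_lower (fun t => (hU v t).1) (hUa v) hv0 hclose hα hηα ht
      rw [← hκ] at hlow
      simp only [hF, max_eq_left hlow]
  refine ⟨w, w', hw, hwa, ?_, fun s hs => ?_⟩
  · rw [← (heq b ⟨hab', le_rfl⟩).1]; exact hv0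
  · rw [← (heq s hs).2]; exact hclose s hs

end IsNormalized

/-! ### Comparison principle for large solutions -/

/-- With `c < 0` the point would also be a local maximum, hence `y` locally constant and `c = 0`. -/
lemma IsLocalMin.second_deriv_nonneg {y y' : ℝ → ℝ} {s c : ℝ} (hy : ∀ t, HasDerivAt y (y' t) t)
    (hc : HasDerivAt y' c s) (hmin : IsLocalMin y s) : 0 ≤ c := by
  by_contra! hneg
  have hd : deriv y = y' := funext fun t => (hy t).deriv
  have hmax : IsLocalMax y s := isLocalMax_of_deriv_deriv_neg (by rw [hd, hc.deriv]; exact hneg)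
    hmin.deriv_eq_zero (hy s).continuousAt
  have heq : y =ᶠ[𝓝 s] fun _ => y s := by
    filter_upwards [hmin, hmax] with t h1 h2 using le_antisymm h2 h1
  have h2 : deriv (deriv y) s = 0 := by
    rw [heq.deriv.deriv_eq]; simp
  rw [hd, hc.deriv] at h2
  exact hneg.ne h2

namespace IsNormalized

variable {g g' p : ℝ → ℝ} {M α : ℝ} {K : NNReal}

lemma sub_le_deriv_mul (h : IsNormalized g g' p M α K) {x y φ : ℝ} (hφ : 0 ≤ φ) (hx : φ ≤ x)
    (hxy : x < y) : g y - g x ≤ g' φ * (y - x) := by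
  obtain ⟨ξ, hξ, he⟩ := exists_hasDerivAt_eq_slope g g' hxy h.continuous.continuousOn
    fun t _ => h.hasDerivAt t
  have h1 : g' ξ ≤ g' φ := h.anti hφ (hφ.trans (hx.trans hξ.1.le)) (hx.trans hξ.1.le)
  rw [eq_div_iff (by linarith)] at he
  rw [← he]
  exact mul_le_mul_of_nonneg_right h1 (by linarith)

/-- A positive strict supersolution of the equation linearised along any large arc. -/
lemma exists_barrier (h : IsNormalized g g' p M α K) {κ : ℝ} (hκ : 0 < κ) :
    ∃ τ > 0, ∀ c d, τ ≤ d - c → ∃ ψ ψ' : ℝ → ℝ, (∀ s, HasDerivAt ψ (ψ' s) s) ∧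
      (∀ s, HasDerivAt ψ' (-(2 * (g' (κ * (d - c) * (s - c)) + g' (κ * (d - c) * (d - s))))) s) ∧
      ∀ s ∈ Icc c d, 1 ≤ ψ s ∧ ψ s ≤ 3 / 2 := by
  obtain ⟨τ, hτ, hd⟩ := h.exists_integral_deficit_le hκ (ε := κ / 8) (by positivity)
  refine ⟨τ, hτ, fun c d hcd => ?_⟩
  have hT : 0 < d - c := hτ.trans_le hcd
  have hdT := hd (d - c) hcd
  set T := d - c with hTdef
  have hcont : Continuous fun r => α - g (κ * T * r) :=
    continuous_const.sub (h.continuous.comp (by fun_prop))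
  -- `l` is an explicit solution of `l'' = -2 * g'(κ * T * x)`, kept below `1 / 4` by the averaged
  -- deficit. Adding its mirror image covers both slopes of the tent, and `ψ ≤ 3 / 2 < 2` makes `ψ`
  -- a strict supersolution.
  set l : ℝ → ℝ := fun x => 2 / (κ * T) * ∫ r in (0 : ℝ)..x, (α - g (κ * T * r)) with hl
  set l' : ℝ → ℝ := fun x => 2 / (κ * T) * (α - g (κ * T * x)) with hl'
  have d1 : ∀ x, HasDerivAt l (l' x) x := fun x =>
    (intervalIntegral.integral_hasDerivAt_right (hcont.intervalIntegrable _ _)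
      (hcont.stronglyMeasurableAtFilter _ _) hcont.continuousAt).const_mul _
  have d2 : ∀ x, HasDerivAt l' (-(2 * g' (κ * T * x))) x := fun x => by
    have e := ((h.hasDerivAt (κ * T * x)).comp x ((hasDerivAt_id x).const_mul (κ * T)))
    refine ((e.const_sub α).const_mul (2 / (κ * T))).congr_deriv ?_
    field_simp
  have hl0 : ∀ x, 0 ≤ x → x ≤ T → 0 ≤ l x ∧ l x ≤ 1 / 4 := by
    intro x hx hxT
    have hnn : ∀ r, 0 ≤ α - g (κ * T * r) := fun r => sub_nonneg.mpr (h.le_lim _)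
    have i1 := intervalIntegral.integral_nonneg (μ := MeasureTheory.volume) hx fun r _ => hnn r
    have i2 := intervalIntegral.integral_nonneg (μ := MeasureTheory.volume) hxT fun r _ => hnn r
    have i3 := intervalIntegral.integral_add_adjacent_intervals
      (hcont.intervalIntegrable (μ := MeasureTheory.volume) 0 x) (hcont.intervalIntegrable x T)
    refine ⟨mul_nonneg (by positivity) i1, ?_⟩
    have : l x ≤ 2 / (κ * T) * (κ / 8 * T) :=
      mul_le_mul_of_nonneg_left (by linarith) (by positivity)
    refine this.trans (le_of_eq ?_)
    field_simp; norm_num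
  refine ⟨fun s => 1 + l (s - c) + l (d - s), fun s => l' (s - c) - l' (d - s), fun s => ?_,
    fun s => ?_, fun s hs => ?_⟩
  · have e1 := (d1 (s - c)).comp s ((hasDerivAt_id s).sub_const c)
    have e2 := (d1 (d - s)).comp s ((hasDerivAt_id s).const_sub d)
    refine ((e1.const_add 1).add e2).congr_deriv ?_
    ring
  · have e1 := (d2 (s - c)).comp s ((hasDerivAt_id s).sub_const c)
    have e2 := (d2 (d - s)).comp s ((hasDerivAt_id s).const_sub d)
    refine (e1.sub e2).congr_deriv ?_
    ring
  · have e1 := hl0 (s - c) (by linarith [hs.1]) (by linarith [hs.2])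
    have e2 := hl0 (d - s) (by linarith [hs.2]) (by linarith [hs.1])
    constructor <;> linarith

/-- Large solutions on a long interval are controlled by their boundary values. -/
theorem exists_stability (h : IsNormalized g g' p M α K) {κ : ℝ} (hκ : 0 < κ) :
    ∃ τ > 0, ∀ c d, τ ≤ d - c → ∀ u u' w w',
      IsSecondOrderSol (fun t x => p t - g x) u u' →
      IsSecondOrderSol (fun t x => p t - g x) w w' →
      (∀ s ∈ Icc c d, κ * (d - c) * min (s - c) (d - s) ≤ u s) →
      (∀ s ∈ Icc c d, κ * (d - c) * min (s - c) (d - s) ≤ w s) →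
      ∀ δ, |u c - w c| ≤ δ → |u d - w d| ≤ δ → ∀ s ∈ Icc c d, |u s - w s| ≤ 2 * δ := by
  obtain ⟨τ, hτ, hb⟩ := h.exists_barrier hκ
  refine ⟨τ, hτ, fun c d hcd => ?_⟩
  obtain ⟨ψ, ψ', hψ, hψ', hψb⟩ := hb c d hcd
  have hT : 0 < d - c := hτ.trans_le hcd
  have key : ∀ u u' w w' : ℝ → ℝ, IsSecondOrderSol (fun t x => p t - g x) u u' →
      IsSecondOrderSol (fun t x => p t - g x) w w' →
      (∀ s ∈ Icc c d, κ * (d - c) * min (s - c) (d - s) ≤ w s) →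
      ∀ δ, |u c - w c| ≤ δ → |u d - w d| ≤ δ → ∀ s ∈ Icc c d, u s - w s ≤ 2 * δ := by
    intro u u' w w' hu hw hwl δ hc hd s hs
    have hδ : 0 ≤ δ := (abs_nonneg _).trans hc
    have hcont : ContinuousOn (fun s => (u s - w s) / ψ s) (Icc c d) :=
      (hu.continuous.sub hw.continuous).continuousOn.div
        (fun s _ => (hψ s).continuousAt.continuousWithinAt)
        fun s hs => (zero_lt_one.trans_le (hψb s hs).1).ne'
    -- At an interior maximum of `(u - w) / ψ` with value `L > δ`, the function `L * ψ - (u - w)`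
    -- has a minimum. But its second derivative is at most `L * g'(φ) * 3 / 2` minus `2 * L` times a
    -- sum exceeding `g'(φ)`, which is negative.
    obtain ⟨m, hm, hmax⟩ := isCompact_Icc.exists_isMaxOn
      (nonempty_Icc.mpr (by linarith : c ≤ d)) hcont
    set L := (u m - w m) / ψ m with hL
    have hψm := hψb m hm
    have hzm : u m - w m = L * ψ m := by
      rw [hL, div_mul_cancel₀]; linarith
    have hle : ∀ s ∈ Icc c d, u s - w s ≤ L * ψ s := fun s hs => by
      have : (u s - w s) / ψ s ≤ L := hmax hs
      rwa [div_le_iff₀ (by linarith [(hψb s hs).1])] at this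
    suffices hLδ : L ≤ δ by
      have h1 := hle s hs
      have h2 := hψb s hs
      have h3 : L * ψ s ≤ δ * ψ s := mul_le_mul_of_nonneg_right hLδ (by linarith)
      have h4 : δ * ψ s ≤ δ * 2 := mul_le_mul_of_nonneg_left (by linarith) hδ
      linarith
    by_contra! hlt
    have hL0 : 0 < L := hδ.trans_lt hlt
    have hmc : m ≠ c := by
      rintro rfl
      have := (le_abs_self _).trans hc
      nlinarith
    have hmd : m ≠ d := by
      rintro rfl
      have := (le_abs_self _).trans hd
      nlinarith
    have hm1 : c < m := lt_of_le_of_ne hm.1 (Ne.symm hmc)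
    have hm2 : m < d := lt_of_le_of_ne hm.2 hmd
    have hmin : IsLocalMin (fun s => L * ψ s - (u s - w s)) m := by
      filter_upwards [Icc_mem_nhds hm1 hm2] with s hs
      have := hle s hs
      linarith
    have hnn := IsLocalMin.second_deriv_nonneg (y' := fun s => L * ψ' s - (u' s - w' s))
      (fun s => ((hψ s).const_mul L).sub ((hu s).1.sub (hw s).1))
      (((hψ' m).const_mul L).sub ((hu m).2.sub (hw m).2)) hmin
    have hwm := hwl m hm
    set φ := κ * (d - c) * min (m - c) (d - m) with hφ
    have hφ0 : 0 ≤ φ := mul_nonneg (by positivity) (le_min (by linarith) (by linarith))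
    have hg := h.sub_le_deriv_mul hφ0 hwm (y := u m) (by nlinarith)
    have hq1 := h.deriv_pos (κ * (d - c) * (m - c)) (mul_nonneg (by positivity) (by linarith))
    have hq2 := h.deriv_pos (κ * (d - c) * (d - m)) (mul_nonneg (by positivity) (by linarith))
    have hq : g' φ < g' (κ * (d - c) * (m - c)) + g' (κ * (d - c) * (d - m)) := by
      rcases le_total (m - c) (d - m) with h4 | h4
      · rw [hφ, min_eq_left h4]; linarith
      · rw [hφ, min_eq_right h4]; linarith
    have hφp := h.deriv_pos φ hφ0
    rw [hzm] at hg
    have h5 : g' φ * (L * ψ m) ≤ g' φ * (L * (3 / 2)) := by gcongr; exact hψm.2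
    have h6 := mul_lt_mul_of_pos_left hq hL0
    have h7 := mul_pos hL0 hφp
    linarith
  intro u u' w w' hu hw hul hwl δ hc hd s hs
  refine abs_le.mpr ⟨?_, key u u' w w' hu hw hwl δ hc hd s hs⟩
  have := key w w' u u' hw hu hul δ (by rwa [abs_sub_comm]) (by rwa [abs_sub_comm]) s hs
  linarith

end IsNormalized

/-! ### The action and its first variation -/

/-- The Lagrangian of `ü + g(u) = p(t)` along `u`. -/
noncomputable def lagrangian (g p u u' : ℝ → ℝ) (s : ℝ) : ℝ :=
  u' s ^ 2 / 2 - (∫ r in (0 : ℝ)..u s, g r) + p s * u s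

/-- The action of `u` on `[a, b]`. -/
noncomputable def action (g p u u' : ℝ → ℝ) (a b : ℝ) : ℝ :=
  ∫ s in a..b, lagrangian g p u u' s

namespace IsNormalized

variable {g g' p : ℝ → ℝ} {M α : ℝ} {K : NNReal} {u u' w w' : ℝ → ℝ}

lemma hasDerivAt_primitive (h : IsNormalized g g' p M α K) (x : ℝ) :
    HasDerivAt (fun x => ∫ r in (0 : ℝ)..x, g r) (g x) x :=
  intervalIntegral.integral_hasDerivAt_right (h.continuous.intervalIntegrable _ _)
    (h.continuous.stronglyMeasurableAtFilter _ _) h.continuous.continuousAt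

lemma continuous_primitive (h : IsNormalized g g' p M α K) :
    Continuous fun x => ∫ r in (0 : ℝ)..x, g r :=
  continuous_iff_continuousAt.mpr fun x => (h.hasDerivAt_primitive x).continuousAt

lemma continuous_lagrangian (h : IsNormalized g g' p M α K)
    (hu : IsSecondOrderSol (fun t x => p t - g x) u u') : Continuous (lagrangian g p u u') := by
  have h1 := h.continuous_primitive.comp hu.continuous
  have h2 := hu.continuous
  have h3 := hu.continuous_deriv
  have h4 := h.p_cont
  unfold lagrangian
  exact (((h3.pow 2).div_const 2).sub h1).add (h4.mul h2)

lemma abs_primitive_le (h : IsNormalized g g' p M α K) (x : ℝ) :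
    |∫ r in (0 : ℝ)..x, g r| ≤ M * |x| := by
  have := intervalIntegral.norm_integral_le_of_norm_le_const (a := 0) (b := x) (f := g) (C := M)
    fun x _ => h.bdd x
  simpa using this

lemma abs_primitive_sub_le (h : IsNormalized g g' p M α K) (x y : ℝ) :
    |(∫ r in (0 : ℝ)..y, g r) - (∫ r in (0 : ℝ)..x, g r) - g x * (y - x)| ≤ K * (y - x) ^ 2 := by
  have hi := fun a b => h.continuous.intervalIntegrable (μ := MeasureTheory.volume) a b
  have e : (∫ r in (0 : ℝ)..y, g r) - (∫ r in (0 : ℝ)..x, g r) - g x * (y - x)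
      = ∫ r in x..y, (g r - g x) := by
    rw [intervalIntegral.integral_sub (hi _ _) (by simp), intervalIntegral.integral_const,
      intervalIntegral.integral_interval_sub_left (hi _ _) (hi _ _), smul_eq_mul]
    ring
  rw [e]
  have := intervalIntegral.norm_integral_le_of_norm_le_const (a := x) (b := y)
    (f := fun r => g r - g x) (C := K * |y - x|) fun r hr => by
      have h1 := h.lip.dist_le_mul r x
      rw [Real.dist_eq, Real.dist_eq] at h1
      exact h1.trans (mul_le_mul_of_nonneg_left
        (abs_sub_left_of_mem_uIcc (uIoc_subset_uIcc hr)) K.2)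
  rwa [Real.norm_eq_abs, mul_assoc, ← sq, sq_abs] at this

lemma abs_deriv_sub_le (h : IsNormalized g g' p M α K)
    (hu : IsSecondOrderSol (fun t x => p t - g x) u u') (s t : ℝ) :
    |u' t - u' s| ≤ 2 * M * |t - s| :=
  convex_univ.norm_image_sub_le_of_norm_hasDerivWithin_le
    (fun x _ => (hu x).2.hasDerivWithinAt)
    (fun x _ => (abs_sub _ _).trans (by linarith [h.p_bdd x, h.bdd (u x)]))
    (mem_univ s) (mem_univ t)

lemma abs_sub_le_of_deriv_le (hu : ∀ t, HasDerivAt u (u' t) t) {a b V : ℝ}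
    (hV : ∀ t ∈ Icc a b, |u' t| ≤ V) {s t : ℝ} (hs : s ∈ Icc a b) (ht : t ∈ Icc a b) :
    |u t - u s| ≤ V * |t - s| :=
  (convex_Icc a b).norm_image_sub_le_of_norm_hasDerivWithin_le
    (fun x _ => (hu x).hasDerivWithinAt) hV hs ht

/-- First order expansions at an endpoint which moves from `a` to `a'`. -/
lemma endpoint_expansion (h : IsNormalized g g' p M α K)
    (hw : IsSecondOrderSol (fun t x => p t - g x) w w') {a a' δ v V C : ℝ} (ha : |a' - a| ≤ δ)
    (hwa : w a' = 0) (hV : |v| ≤ V) (hwV : ∀ s ∈ uIcc a a', |w' s| ≤ V) (hv : |w' a - v| ≤ C * δ) :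
    |w a + v * (a' - a)| ≤ (2 * M + C) * δ * δ ∧
      |(∫ s in a..a', lagrangian g p w w' s) - v ^ 2 / 2 * (a' - a)|
        ≤ ((2 * M + C) * V + 2 * M * V) * δ * δ := by
  have hδ : 0 ≤ δ := (abs_nonneg _).trans ha
  have hM := h.bound_pos
  have hV0 : 0 ≤ V := (abs_nonneg _).trans hV
  have hdist : ∀ s ∈ uIcc a a', |s - a| ≤ δ := fun s hs => (abs_sub_left_of_mem_uIcc hs).trans ha
  have hdist' : ∀ s ∈ uIcc a a', |s - a'| ≤ δ := fun s hs => by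
    rw [abs_sub_comm]
    exact (abs_sub_right_of_mem_uIcc hs).trans ha
  have hvel : ∀ s ∈ uIcc a a', |w' s - v| ≤ (2 * M + C) * δ := fun s hs => by
    have h1 := h.abs_deriv_sub_le hw a s
    have h2 := mul_le_mul_of_nonneg_left (hdist s hs) (by positivity : 0 ≤ 2 * M)
    have h3 := abs_sub_le (w' s) (w' a) v
    linarith
  constructor
  · have h1 := (convex_uIcc a a').norm_image_sub_le_of_norm_hasDerivWithin_le
      (f := fun s => w s - v * s) (f' := fun s => w' s - v * 1)
      (fun x _ => ((hw x).1.sub ((hasDerivAt_id x).const_mul v)).hasDerivWithinAt)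
      (fun s hs => by rw [mul_one]; exact hvel s hs) right_mem_uIcc left_mem_uIcc
    have e : w a - v * a - (w a' - v * a') = w a + v * (a' - a) := by rw [hwa]; ring
    rw [e, Real.norm_eq_abs, Real.norm_eq_abs, abs_sub_comm a a'] at h1
    have h0 : 0 ≤ (2 * M + C) * δ := (abs_nonneg _).trans (hvel a left_mem_uIcc)
    exact h1.trans (mul_le_mul_of_nonneg_left ha h0)
  · have hval : ∀ s ∈ uIcc a a', |w s| ≤ V * δ := fun s hs => by
      have := (convex_uIcc a a').norm_image_sub_le_of_norm_hasDerivWithin_le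
        (fun x _ => (hw x).1.hasDerivWithinAt) hwV right_mem_uIcc hs
      rw [hwa, sub_zero, Real.norm_eq_abs, Real.norm_eq_abs] at this
      exact this.trans (mul_le_mul_of_nonneg_left (hdist' s hs) hV0)
    have hL : ∀ s ∈ uIcc a a', |lagrangian g p w w' s - v ^ 2 / 2|
        ≤ ((2 * M + C) * V + 2 * M * V) * δ := by
      intro s hs
      have e : lagrangian g p w w' s - v ^ 2 / 2
          = (w' s - v) * ((w' s + v) / 2) - (∫ r in (0 : ℝ)..w s, g r) + p s * w s := by
        unfold lagrangian; ring
      have h0 : 0 ≤ (2 * M + C) * δ := (abs_nonneg _).trans (hvel a left_mem_uIcc)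
      have e1 : |(w' s - v) * ((w' s + v) / 2)| ≤ (2 * M + C) * δ * V := by
        rw [abs_mul]
        refine mul_le_mul (hvel s hs) ?_ (abs_nonneg _) h0
        rw [abs_div, abs_two]
        have := abs_add_le (w' s) v
        linarith [hwV s hs]
      have e2 : |∫ r in (0 : ℝ)..w s, g r| ≤ M * (V * δ) :=
        (h.abs_primitive_le _).trans (mul_le_mul_of_nonneg_left (hval s hs) hM.le)
      have e3 : |p s * w s| ≤ M * (V * δ) := by
        rw [abs_mul]
        exact mul_le_mul (h.p_bdd s) (hval s hs) (abs_nonneg _) hM.le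
      rw [e]
      have t1 := abs_add_le ((w' s - v) * ((w' s + v) / 2) - (∫ r in (0 : ℝ)..w s, g r)) (p s * w s)
      have t2 := abs_sub ((w' s - v) * ((w' s + v) / 2)) (∫ r in (0 : ℝ)..w s, g r)
      linarith
    have hc := h.continuous_lagrangian hw
    have e : (∫ s in a..a', lagrangian g p w w' s) - v ^ 2 / 2 * (a' - a)
        = ∫ s in a..a', (lagrangian g p w w' s - v ^ 2 / 2) := by
      rw [intervalIntegral.integral_sub (hc.intervalIntegrable _ _) (by simp),
        intervalIntegral.integral_const, smul_eq_mul]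
      ring
    rw [e]
    have := intervalIntegral.norm_integral_le_of_norm_le_const (a := a) (b := a')
      (f := fun s => lagrangian g p w w' s - v ^ 2 / 2)
      (C := ((2 * M + C) * V + 2 * M * V) * δ) fun s hs => hL s (uIoc_subset_uIcc hs)
    refine this.trans (mul_le_mul_of_nonneg_left ha ?_)
    exact (abs_nonneg _).trans (hL a left_mem_uIcc)

/-- The action of a nearby solution, up to second order. -/
lemma action_sub_expansion (h : IsNormalized g g' p M α K)
    (hu : IsSecondOrderSol (fun t x => p t - g x) u u')
    (hw : IsSecondOrderSol (fun t x => p t - g x) w w') {a b δ : ℝ} (hab : a ≤ b)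
    (h0 : ∀ s ∈ Icc a b, |w s - u s| ≤ δ) (h1 : ∀ s ∈ Icc a b, |w' s - u' s| ≤ δ) :
    |action g p w w' a b - action g p u u' a b
        - (u' b * (w b - u b) - u' a * (w a - u a))| ≤ (1 + K) * δ ^ 2 * (b - a) := by
  have cw := h.continuous_lagrangian hw
  have cu := h.continuous_lagrangian hu
  -- Because `u` satisfies the Euler–Lagrange equation, the linear part of the variation is the
  -- derivative of `u' * (w - u)`. What remains is quadratic in `w - u` and `w' - u'`.
  have hder : ∀ s, HasDerivAt (fun s => u' s * (w s - u s))
      ((p s - g (u s)) * (w s - u s) + u' s * (w' s - u' s)) s := fun s =>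
    (hu s).2.mul ((hw s).1.sub (hu s).1)
  have cd : Continuous fun s => (p s - g (u s)) * (w s - u s) + u' s * (w' s - u' s) := by
    have := hu.continuous
    have := hw.continuous
    have := hu.continuous_deriv
    have := hw.continuous_deriv
    have := h.continuous
    have := h.p_cont
    fun_prop
  have e1 := intervalIntegral.integral_eq_sub_of_hasDerivAt (a := a) (b := b)
    (fun s _ => hder s) (cd.intervalIntegrable _ _)
  have e2 : action g p w w' a b - action g p u u' a b
        - (u' b * (w b - u b) - u' a * (w a - u a))
      = ∫ s in a..b, (lagrangian g p w w' s - lagrangian g p u u' s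
          - ((p s - g (u s)) * (w s - u s) + u' s * (w' s - u' s))) := by
    rw [intervalIntegral.integral_sub
      (f := fun s => lagrangian g p w w' s - lagrangian g p u u' s)
      ((cw.sub cu).intervalIntegrable _ _) (cd.intervalIntegrable _ _), intervalIntegral.integral_sub (cw.intervalIntegrable _ _)
      (cu.intervalIntegrable _ _), e1]
    rfl
  rw [e2]
  have := intervalIntegral.norm_integral_le_of_norm_le_const (a := a) (b := b)
    (f := fun s => lagrangian g p w w' s - lagrangian g p u u' s
          - ((p s - g (u s)) * (w s - u s) + u' s * (w' s - u' s)))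
    (C := (1 + K) * δ ^ 2) fun s hs => by
      rw [uIoc_of_le hab] at hs
      have hs' := Ioc_subset_Icc_self hs
      have k0 := sq_le_sq' (abs_le.mp (h0 s hs')).1 (abs_le.mp (h0 s hs')).2
      have k1 := sq_le_sq' (abs_le.mp (h1 s hs')).1 (abs_le.mp (h1 s hs')).2
      have k2 := abs_le.mp (h.abs_primitive_sub_le (u s) (w s))
      have k3 : (K : ℝ) * (w s - u s) ^ 2 ≤ K * δ ^ 2 := mul_le_mul_of_nonneg_left k0 K.2
      have e : lagrangian g p w w' s - lagrangian g p u u' s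
          - ((p s - g (u s)) * (w s - u s) + u' s * (w' s - u' s))
          = (w' s - u' s) ^ 2 / 2 - ((∫ r in (0 : ℝ)..w s, g r) - (∫ r in (0 : ℝ)..u s, g r)
            - g (u s) * (w s - u s)) := by
        unfold lagrangian; ring
      rw [e, Real.norm_eq_abs]
      exact abs_le.mpr ⟨by nlinarith [sq_nonneg (w' s - u' s)], by nlinarith [sq_nonneg (w' s - u' s)]⟩
  rwa [abs_of_nonneg (sub_nonneg.mpr hab), Real.norm_eq_abs] at this

end IsNormalized

/-! ### Dependence of arcs and of their action on the endpoints -/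

namespace IsNormalized

variable {g g' p : ℝ → ℝ} {M α η : ℝ} {K : NNReal} {u u' w w' : ℝ → ℝ}

/-- The arc estimate controls the velocity at `a`, and `|u''| ≤ 2 * M` propagates it beyond `[a,
b]`; needed since arcs with different endpoints are compared on a common larger interval. -/
lemma arc_deriv_le (h : IsNormalized g g' p M α K) (hη : η ≤ α / 8) {a b c d : ℝ}
    (hu : IsArc g p α η a b u u') (hab : a ≤ b) (hca : c ≤ a) (hbd : b ≤ d) {s : ℝ}
    (hs : s ∈ Icc c d) : |u' s| ≤ (α + 2 * M) * (d - c) := by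
  have hα := h.pos
  have hM := h.bound_pos
  have h1 := abs_le.mp (hu.deriv_le a ⟨le_rfl, hab⟩)
  have h2 := abs_le.mp (h.abs_deriv_sub_le hu.sol a s)
  have h3 : |s - a| ≤ d - c := abs_le.mpr ⟨by linarith [hs.1], by linarith [hs.2]⟩
  have h4 := mul_le_mul_of_nonneg_left h3 (by positivity : 0 ≤ 2 * M)
  have h5 : η * (b - a) ≤ α / 8 * (b - a) := mul_le_mul_of_nonneg_right hη (by linarith)
  have h6 : α * (b - a) ≤ α * (d - c) := mul_le_mul_of_nonneg_left (by linarith) hα.le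
  have h7 : 0 ≤ α * (b - a) := mul_nonneg hα.le (by linarith)
  exact abs_le.mpr ⟨by linarith [h1.1, h2.1], by linarith [h1.2, h2.2]⟩

/-- Arcs depend in a Lipschitz way on their endpoints; in particular they are unique. -/
theorem exists_arc_close (h : IsNormalized g g' p M α K) :
    ∃ τ > 0, ∀ η ≤ α / 8, ∀ a b, τ < b - a → ∃ C ≥ 0, ∃ δ₀ > 0, δ₀ ≤ 1 ∧
      ∀ a' b' δ, |a' - a| ≤ δ → |b' - b| ≤ δ → δ ≤ δ₀ → a' ≤ b' ∧
        ∀ u u' w w', IsArc g p α η a b u u' → IsArc g p α η a' b' w w' →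
          ∀ s ∈ Icc (a - 1) (b + 1), |w s - u s| ≤ C * δ ∧ |w' s - u' s| ≤ C * δ := by
  have hα := h.pos
  have hM := h.bound_pos
  obtain ⟨τ, hτ, hstab⟩ := h.exists_stability (κ := α / 8) (by positivity)
  refine ⟨τ, hτ, fun η hη a b hab => ?_⟩
  set V : ℝ := (α + 2 * M) * (b + 1 - (a - 1)) with hV
  have hV0 : 0 ≤ V := mul_nonneg (by positivity) (by linarith)
  set E : ℝ := Real.exp (max 1 K * (b - a + 2)) with hE
  refine ⟨(2 * V + 2 * V / τ) * E, by positivity, min 1 ((b - a - τ) / 2),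
    lt_min one_pos (by linarith), min_le_left _ _, fun a' b' δ ha hb hδ => ?_⟩
  have hδ1 : δ ≤ 1 := hδ.trans (min_le_left _ _)
  have hδ2 : δ ≤ (b - a - τ) / 2 := hδ.trans (min_le_right _ _)
  have hδ0 : 0 ≤ δ := (abs_nonneg _).trans ha
  have ha' := abs_le.mp ha
  have hb' := abs_le.mp hb
  have hab' : a' ≤ b' := by linarith
  refine ⟨hab', fun u u' w w' hu hw s hs => ?_⟩
  have huV : ∀ s ∈ Icc (a - 1) (b + 1), |u' s| ≤ V := fun s hs =>
    h.arc_deriv_le hη hu (by linarith) (by linarith) (by linarith) hs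
  have hwV : ∀ s ∈ Icc (a - 1) (b + 1), |w' s| ≤ V := fun s hs =>
    h.arc_deriv_le hη hw hab' (by linarith) (by linarith) hs
  have uLip := fun s t hs ht => abs_sub_le_of_deriv_le (fun t => (hu.sol t).1) huV (s := s) (t := t) hs ht
  have wLip := fun s t hs ht => abs_sub_le_of_deriv_le (fun t => (hw.sol t).1) hwV (s := s) (t := t) hs ht
  -- On the overlap `[c, d]` both arcs lie above the tent of `[c, d]`, and at each end one of them
  -- vanishes, so the other is at most `V * δ` there. Stability then applies.
  set c := max a a' with hc
  set d := min b b' with hd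
  have hac : a ≤ c := le_max_left _ _
  have hac' : a' ≤ c := le_max_right _ _
  have hdb : d ≤ b := min_le_left _ _
  have hdb' : d ≤ b' := min_le_right _ _
  have hcu : c ≤ a + δ := max_le (by linarith) (by linarith)
  have hdl : b - δ ≤ d := le_min (by linarith) (by linarith)
  have hcd : τ ≤ d - c := by linarith
  have hzc : |u c - w c| ≤ V * δ := by
    rcases le_total a a' with hle | hle
    · have e : c = a' := max_eq_right hle
      rw [e, hw.left, sub_zero]
      have := uLip a a' ⟨by linarith, by linarith⟩ ⟨by linarith, by linarith⟩
      rw [hu.left, sub_zero] at this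
      exact this.trans (mul_le_mul_of_nonneg_left ha hV0)
    · have e : c = a := max_eq_left hle
      rw [e, hu.left, zero_sub, abs_neg]
      have := wLip a' a ⟨by linarith, by linarith⟩ ⟨by linarith, by linarith⟩
      rw [hw.left, sub_zero, abs_sub_comm a] at this
      exact this.trans (mul_le_mul_of_nonneg_left ha hV0)
  have hzd : |u d - w d| ≤ V * δ := by
    rcases le_total b b' with hle | hle
    · have e : d = b := min_eq_left hle
      rw [e, hu.right, zero_sub, abs_neg]
      have := wLip b' b ⟨by linarith, by linarith⟩ ⟨by linarith, by linarith⟩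
      rw [hw.right, sub_zero, abs_sub_comm b] at this
      exact this.trans (mul_le_mul_of_nonneg_left hb hV0)
    · have e : d = b' := min_eq_right hle
      rw [e, hw.right, sub_zero]
      have := uLip b b' ⟨by linarith, by linarith⟩ ⟨by linarith, by linarith⟩
      rw [hu.right, sub_zero] at this
      exact this.trans (mul_le_mul_of_nonneg_left hb hV0)
  have hlow : ∀ {a₁ b₁ : ℝ} {v v' : ℝ → ℝ}, a₁ ≤ c → d ≤ b₁ → IsArc g p α η a₁ b₁ v v' →
      ∀ s ∈ Icc c d, α / 8 * (d - c) * min (s - c) (d - s) ≤ v s := by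
    intro a₁ b₁ v v' h1 h2 hv s hs
    refine le_trans ?_ (parabola_lower (fun t => (hv.sol t).1) hv.left hv.right hv.deriv_le hα hη
      (s := s) ⟨h1.trans hs.1, hs.2.trans h2⟩)
    have h3 : 0 ≤ min (s - c) (d - s) := le_min (by linarith [hs.1]) (by linarith [hs.2])
    have h4 : 0 ≤ b₁ - a₁ := by linarith [hs.1, hs.2]
    gcongr
  have hz := hstab c d hcd u u' w w' hu.sol hw.sol (hlow hac hdb hu) (hlow hac' hdb' hw)
    (V * δ) hzc hzd
  have hcd' : c < d := by linarith
  -- The mean value theorem gives a point where the velocities are close too; continuous dependence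
  -- from there reaches all of `[a - 1, b + 1]`.
  obtain ⟨ξ, hξ, hξe⟩ := exists_hasDerivAt_eq_slope (fun s => u s - w s) (fun s => u' s - w' s) hcd'
    (hu.sol.continuous.sub hw.sol.continuous).continuousOn
    fun x _ => ((hu.sol x).1.sub (hw.sol x).1)
  have hξ1 : |u' ξ - w' ξ| ≤ 2 * V / τ * δ := by
    have e : u' ξ - w' ξ = (u d - w d - (u c - w c)) / (d - c) := hξe
    rw [e, abs_div, abs_of_pos (by linarith : 0 < d - c), div_le_iff₀ (by linarith)]
    have h1 := abs_sub (u d - w d) (u c - w c)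
    have h2 : 2 * V / τ * δ * τ ≤ 2 * V / τ * δ * (d - c) :=
      mul_le_mul_of_nonneg_left hcd (by positivity)
    have h3 : 2 * V / τ * δ * τ = 2 * V * δ := by field_simp
    linarith
  have hξ0 := hz ξ (Ioo_subset_Icc_self hξ)
  have hdep := hu.sol.dist_le (fun t => h.lip.const_sub_real (p t)) hw.sol (t₀ := ξ)
    (δ := (2 * V + 2 * V / τ) * δ)
    (hξ0.trans (by nlinarith [div_nonneg (mul_nonneg zero_le_two hV0) hτ.le]))
    (hξ1.trans (by nlinarith)) s
  have hEs : Real.exp (max 1 K * |s - ξ|) ≤ E := by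
    refine Real.exp_le_exp.mpr (mul_le_mul_of_nonneg_left ?_ (by positivity))
    exact abs_le.mpr ⟨by linarith [hs.1, hξ.2], by linarith [hs.2, hξ.1]⟩
  have hfin : (2 * V + 2 * V / τ) * δ * Real.exp (max 1 K * |s - ξ|)
      ≤ (2 * V + 2 * V / τ) * E * δ := by
    have := mul_le_mul_of_nonneg_left hEs (by positivity : 0 ≤ (2 * V + 2 * V / τ) * δ)
    linarith
  rw [abs_sub_comm (w s), abs_sub_comm (w' s)]
  exact ⟨hdep.1.trans hfin, hdep.2.trans hfin⟩

/-- The action of arcs is differentiable with respect to the endpoints. -/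
theorem exists_action_expansion (h : IsNormalized g g' p M α K) :
    ∃ τ > 0, ∀ η ≤ α / 8, ∀ a b, τ < b - a → ∃ C, ∃ δ₀ > 0,
      ∀ a' b' δ, |a' - a| ≤ δ → |b' - b| ≤ δ → δ ≤ δ₀ →
        ∀ u u' w w', IsArc g p α η a b u u' → IsArc g p α η a' b' w w' →
          |action g p w w' a' b' - action g p u u' a b
            - (u' a ^ 2 / 2 * (a' - a) - u' b ^ 2 / 2 * (b' - b))| ≤ C * δ ^ 2 := by
  have hα := h.pos
  have hM := h.bound_pos
  obtain ⟨τ, hτ, hcl⟩ := h.exists_arc_close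
  refine ⟨τ, hτ, fun η hη a b hab => ?_⟩
  obtain ⟨C, hC, δ₀, hδ₀, hδ₁, hclose⟩ := hcl η hη a b hab
  set V : ℝ := (α + 2 * M) * (b + 1 - (a - 1)) with hV
  have hV0 : 0 ≤ V := mul_nonneg (by positivity) (by linarith)
  refine ⟨(1 + K) * C ^ 2 * (b - a) + 2 * (V * (2 * M + C)) + 2 * ((2 * M + C) * V + 2 * M * V),
    δ₀, hδ₀, fun a' b' δ ha hb hδ u u' w w' hu hw => ?_⟩
  obtain ⟨hab', hcl'⟩ := hclose a' b' δ ha hb hδ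
  have hz := hcl' u u' w w' hu hw
  have hδ1 : δ ≤ 1 := hδ.trans hδ₁
  have hδ0 : 0 ≤ δ := (abs_nonneg _).trans ha
  have ha' := abs_le.mp ha
  have hb' := abs_le.mp hb
  have huV : ∀ s ∈ Icc (a - 1) (b + 1), |u' s| ≤ V := fun s hs =>
    h.arc_deriv_le hη hu (by linarith) (by linarith) (by linarith) hs
  have hwV : ∀ s ∈ Icc (a - 1) (b + 1), |w' s| ≤ V := fun s hs =>
    h.arc_deriv_le hη hw hab' (by linarith) (by linarith) hs
  have hIa : uIcc a a' ⊆ Icc (a - 1) (b + 1) :=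
    uIcc_subset_Icc ⟨by linarith, by linarith⟩ ⟨by linarith, by linarith⟩
  have hIb : uIcc b b' ⊆ Icc (a - 1) (b + 1) :=
    uIcc_subset_Icc ⟨by linarith, by linarith⟩ ⟨by linarith, by linarith⟩
  have hIab : Icc a b ⊆ Icc (a - 1) (b + 1) := Icc_subset_Icc (by linarith) (by linarith)
  have hma : a ∈ Icc (a - 1) (b + 1) := hIa left_mem_uIcc
  have hmb : b ∈ Icc (a - 1) (b + 1) := hIb left_mem_uIcc
  obtain ⟨pa, qa⟩ := h.endpoint_expansion hw.sol ha hw.left (huV a hma) (fun s hs => hwV s (hIa hs))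
    (hz a hma).2
  obtain ⟨pb, qb⟩ := h.endpoint_expansion hw.sol hb hw.right (huV b hmb) (fun s hs => hwV s (hIb hs))
    (hz b hmb).2
  have hexp := h.action_sub_expansion hu.sol hw.sol (by linarith : a ≤ b)
    (fun s hs => (hz s (hIab hs)).1) (fun s hs => (hz s (hIab hs)).2)
  rw [hu.left, hu.right, sub_zero, sub_zero] at hexp
  have cw := fun x y => (h.continuous_lagrangian hw.sol).intervalIntegrable
    (μ := MeasureTheory.volume) x y
  -- Since `w a' = 0`, one has `w a ≈ -u' a * (a' - a)`, so the boundary term at `a` contributes `u'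
  -- a ^ 2 * (a' - a)`; the slice between `a` and `a'` takes away half of it. The end `b` is
  -- analogous with opposite sign.
  have hsplit : action g p w w' a' b' = action g p w w' a b
      - (∫ s in a..a', lagrangian g p w w' s) + ∫ s in b..b', lagrangian g p w w' s := by
    unfold action
    rw [← intervalIntegral.integral_add_adjacent_intervals (cw a' a) (cw a b'),
      ← intervalIntegral.integral_add_adjacent_intervals (cw a b) (cw b b'),
      intervalIntegral.integral_symm a a']
    ring
  have e1 : |u' a * (w a + u' a * (a' - a))| ≤ V * ((2 * M + C) * δ * δ) := by
    rw [abs_mul]; exact mul_le_mul (huV a hma) pa (abs_nonneg _) hV0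
  have e2 : |u' b * (w b + u' b * (b' - b))| ≤ V * ((2 * M + C) * δ * δ) := by
    rw [abs_mul]; exact mul_le_mul (huV b hmb) pb (abs_nonneg _) hV0
  rw [hsplit]
  have f1 := abs_le.mp e1
  have f2 := abs_le.mp e2
  have f3 := abs_le.mp qa
  have f4 := abs_le.mp qb
  have f5 := abs_le.mp hexp
  refine abs_le.mpr ⟨?_, ?_⟩
  · linarith [f1.2, f2.1, f3.2, f4.1, f5.1]
  · linarith [f1.1, f2.2, f3.1, f4.2, f5.2]

end IsNormalized

/-! ### Size of arcs and cubic growth of the action -/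

lemma hasDerivAt_of_abs_sub_le_sq {f : ℝ → ℝ} {c b C : ℝ}
    (h : ∀ᶠ s in 𝓝 b, |f s - f b - c * (s - b)| ≤ C * (s - b) ^ 2) : HasDerivAt f c b := by
  have hO : (fun s => f s - f b - c * (s - b)) =O[𝓝 b] fun s => ‖s - b‖ ^ 2 :=
    Asymptotics.IsBigO.of_bound C (by
      filter_upwards [h] with s hs
      simpa using hs)
  have h0 := (hO.hasFDerivAt (by norm_num)).hasDerivAt
  have h1 : HasDerivAt (fun s => f b + c * (s - b)) (c * 1) b :=
    (((hasDerivAt_id b).sub_const b).const_mul c).const_add (f b)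
  refine ((h0.add h1).congr_deriv (by simp)).congr_of_eventuallyEq (Eventually.of_forall fun s => ?_)
  simp only [Pi.add_apply]
  ring

namespace IsArc

variable {g p : ℝ → ℝ} {α η a b : ℝ} {u u' : ℝ → ℝ}

lemma lower (h : IsArc g p α η a b u u') (hα : 0 < α) (hη : η ≤ α / 8) {s : ℝ}
    (hs : s ∈ Icc a b) : α / 8 * (b - a) * min (s - a) (b - s) ≤ u s :=
  parabola_lower (fun t => (h.sol t).1) h.left h.right h.deriv_le hα hη hs

lemma nonneg (h : IsArc g p α η a b u u') (hα : 0 < α) (hη : η ≤ α / 8) {s : ℝ}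
    (hs : s ∈ Icc a b) : 0 ≤ u s :=
  (mul_nonneg (mul_nonneg (by positivity) (by linarith [hs.1, hs.2]))
    (le_min (by linarith [hs.1]) (by linarith [hs.2]))).trans (h.lower hα hη hs)

lemma abs_deriv_le (h : IsArc g p α η a b u u') (hα : 0 < α) (hη : η ≤ α / 8) {s : ℝ}
    (hs : s ∈ Icc a b) : |u' s| ≤ α * (b - a) := by
  have h1 := abs_le.mp (h.deriv_le s hs)
  have hab : 0 ≤ b - a := by linarith [hs.1, hs.2]
  have h2 : η * (b - a) ≤ α / 8 * (b - a) := mul_le_mul_of_nonneg_right hη hab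
  have h3 : 0 ≤ α * (b - a) := mul_nonneg hα.le hab
  have h4 : |α * ((a + b) / 2 - s)| ≤ α * ((b - a) / 2) := by
    rw [abs_mul, abs_of_pos hα]
    exact mul_le_mul_of_nonneg_left (abs_le.mpr ⟨by linarith [hs.2], by linarith [hs.1]⟩) hα.le
  have h5 := abs_le.mp h4
  exact abs_le.mpr ⟨by linarith [h1.1, h5.1], by linarith [h1.2, h5.2]⟩

lemma upper (h : IsArc g p α η a b u u') (hα : 0 < α) (hη : η ≤ α / 8) {s : ℝ}
    (hs : s ∈ Icc a b) : u s ≤ α * (b - a) ^ 2 := by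
  have h1 := IsNormalized.abs_sub_le_of_deriv_le (fun t => (h.sol t).1)
    (fun t ht => h.abs_deriv_le hα hη ht) (left_mem_Icc.mpr (hs.1.trans hs.2)) hs
  rw [h.left, sub_zero] at h1
  have hab : 0 ≤ b - a := by linarith [hs.1, hs.2]
  have h2 : |s - a| ≤ b - a := abs_le.mpr ⟨by linarith [hs.1], by linarith [hs.2]⟩
  have h3 := mul_le_mul_of_nonneg_left h2 (mul_nonneg hα.le hab)
  have h4 := le_abs_self (u s)
  linarith

lemma deriv_left_pos (h : IsArc g p α η a b u u') (hα : 0 < α) (hη : η ≤ α / 8) (hab : a < b) :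
    0 < u' a := by
  have h1 := (abs_le.mp (h.deriv_le a ⟨le_rfl, hab.le⟩)).1
  have h2 : η * (b - a) ≤ α / 8 * (b - a) := mul_le_mul_of_nonneg_right hη (by linarith)
  have h3 : 0 < α * (b - a) := mul_pos hα (by linarith)
  linarith

lemma deriv_right_neg (h : IsArc g p α η a b u u') (hα : 0 < α) (hη : η ≤ α / 8) (hab : a < b) :
    u' b < 0 := by
  have h1 := (abs_le.mp (h.deriv_le b ⟨hab.le, le_rfl⟩)).2
  have h2 : η * (b - a) ≤ α / 8 * (b - a) := mul_le_mul_of_nonneg_right hη (by linarith)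
  have h3 : 0 < α * (b - a) := mul_pos hα (by linarith)
  linarith

end IsArc

namespace IsNormalized

variable {g g' p : ℝ → ℝ} {M α η : ℝ} {K : NNReal} {u u' w w' : ℝ → ℝ}

/-- The quantity is the integral of `g x - g r` over `[0, x]`: nonnegative by monotonicity, and
sublinear because the integrand is at most `ε` once `r ≥ R`. -/
lemma exists_virial_le (h : IsNormalized g g' p M α K) {ε : ℝ} (hε : 0 < ε) :
    ∃ R > 0, ∀ x, 0 ≤ x → 0 ≤ x * g x - (∫ r in (0 : ℝ)..x, g r) ∧
      x * g x - (∫ r in (0 : ℝ)..x, g r) ≤ 2 * M * R + ε * x := by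
  obtain ⟨R, hR, hRg⟩ := h.exists_deficit_le hε
  have hM := h.bound_pos
  refine ⟨R, hR, fun x hx => ?_⟩
  have hi := fun a b => h.continuous.intervalIntegrable (μ := MeasureTheory.volume) a b
  have e : x * g x - (∫ r in (0 : ℝ)..x, g r) = ∫ r in (0 : ℝ)..x, (g x - g r) := by
    rw [intervalIntegral.integral_sub (by simp) (hi _ _), intervalIntegral.integral_const,
      smul_eq_mul, sub_zero]
  have hj : ∀ a b, IntervalIntegrable (fun r => g x - g r) MeasureTheory.volume a b := fun a b =>
    (continuous_const.sub h.continuous).intervalIntegrable a b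
  rw [e]
  refine ⟨intervalIntegral.integral_nonneg hx fun r hr => sub_nonneg.mpr (h.mono hr.2), ?_⟩
  have hg2 : ∀ r, g x - g r ≤ α - g r := fun r => by linarith [h.le_lim x]
  have hb : ∀ a b, a ≤ b → ∫ r in a..b, (g x - g r) ≤ 2 * M * (b - a) := by
    intro a b hab
    have := intervalIntegral.integral_mono_on (f := fun r => g x - g r) (g := fun _ => 2 * M) hab
      (hj a b) (by simp) fun r _ => (hg2 r).trans (h.deficit_le r)
    rw [intervalIntegral.integral_const, smul_eq_mul] at this
    linarith
  rcases le_total x R with hxR | hxR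
  · have h1 := hb 0 x hx
    have h2 : 2 * M * x ≤ 2 * M * R := mul_le_mul_of_nonneg_left hxR (by positivity)
    have h3 : 0 ≤ ε * x := by positivity
    linarith
  · rw [← intervalIntegral.integral_add_adjacent_intervals (hj 0 R) (hj R x)]
    have h1 := hb 0 R hR.le
    have h2 := intervalIntegral.integral_mono_on (f := fun r => g x - g r) (g := fun _ => ε) hxR
      (hj R x) (by simp) fun r hr => (hg2 r).trans (hRg r hr.1)
    rw [intervalIntegral.integral_const, smul_eq_mul] at h2
    have h3 : 0 ≤ ε * R := by positivity
    linarith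

/-- The action of a solution between two zeros, after multiplying the equation by `u`. -/
lemma action_eq (h : IsNormalized g g' p M α K)
    (hu : IsSecondOrderSol (fun t x => p t - g x) u u') {a b : ℝ} (ha : u a = 0) (hb : u b = 0) :
    action g p u u' a b
      = ∫ s in a..b, (-(u' s ^ 2 / 2) + (u s * g (u s) - ∫ r in (0 : ℝ)..u s, g r)) := by
  have cu := h.continuous_lagrangian hu
  have cd : Continuous fun s => u' s * u' s + u s * (p s - g (u s)) := by
    have := hu.continuous
    have := hu.continuous_deriv
    have := h.continuous
    have := h.p_cont
    fun_prop
  have e1 := intervalIntegral.integral_eq_sub_of_hasDerivAt (a := a) (b := b)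
    (fun s _ => (hu s).1.mul (hu s).2) (cd.intervalIntegrable _ _)
  simp only [Pi.mul_apply, ha, hb, zero_mul, sub_zero] at e1
  have e2 : action g p u u' a b = ∫ s in a..b,
      (lagrangian g p u u' s - (u' s * u' s + u s * (p s - g (u s)))) := by
    rw [intervalIntegral.integral_sub (cu.intervalIntegrable _ _) (cd.intervalIntegrable _ _), e1,
      sub_zero]
    rfl
  rw [e2]
  refine intervalIntegral.integral_congr fun s _ => ?_
  simp only [lagrangian]
  ring

/-- The action of an arc is asymptotically cubic in its length. -/
theorem exists_action_estimate (h : IsNormalized g g' p M α K) {ε : ℝ} (hε : 0 < ε) :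
    ∃ η > 0, η ≤ α / 8 ∧ ∃ τ > 0, ∀ a b, τ ≤ b - a → ∀ u u', IsArc g p α η a b u u' →
      |-action g p u u' a b - α ^ 2 / 24 * (b - a) ^ 3| ≤ ε * (b - a) ^ 3 := by
  have hα := h.pos
  have hM := h.bound_pos
  obtain ⟨R, hR, hvir⟩ := h.exists_virial_le (ε := ε / (3 * α)) (by positivity)
  -- Three errors of at most `ε / 3 * (b - a) ^ 2` each: the deviation of the velocity from that of
  -- the parabola, the linear part of the virial term (as `u ≤ α * (b - a) ^ 2`), and its constant
  -- part `2 * M * R`.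
  refine ⟨min (α / 8) (ε / (3 * α)), by positivity, min_le_left _ _, 1 + 6 * M * R / ε,
    by positivity, fun a b hab u u' hu => ?_⟩
  set η := min (α / 8) (ε / (3 * α)) with hη
  have hη1 : η ≤ α / 8 := min_le_left _ _
  have hη2 : η * (3 * α) ≤ ε := by
    have : η ≤ ε / (3 * α) := min_le_right _ _
    rwa [le_div_iff₀ (by positivity)] at this
  have hη0 : 0 < η := by positivity
  have hq : 0 < 6 * M * R / ε := by positivity
  have hT : 1 ≤ b - a := by linarith
  have hT' : 6 * M * R ≤ ε * (b - a) ^ 2 := by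
    have h1 : 6 * M * R / ε ≤ (b - a) ^ 2 := by nlinarith
    rw [div_le_iff₀ hε] at h1
    linarith
  have hab' : a ≤ b := by linarith
  -- In `action_eq` the main term is minus the kinetic energy; this is the kinetic energy of the
  -- parabola.
  have hint : ∫ s in a..b, (α * ((a + b) / 2 - s)) ^ 2 / 2 = α ^ 2 / 24 * (b - a) ^ 3 := by
    have hd : ∀ s, HasDerivAt (fun s => -(α ^ 2 / 6 * ((a + b) / 2 - s) ^ 3))
        ((α * ((a + b) / 2 - s)) ^ 2 / 2) s := fun s => by
      refine ((((hasDerivAt_id s).const_sub ((a + b) / 2)).pow 3).const_mul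
        (α ^ 2 / 6)).neg.congr_deriv ?_
      norm_num; ring
    rw [intervalIntegral.integral_eq_sub_of_hasDerivAt (fun s _ => hd s)
      (by apply Continuous.intervalIntegrable; fun_prop)]
    ring
  have c1 : Continuous fun s => -(u' s ^ 2 / 2) + (u s * g (u s) - ∫ r in (0 : ℝ)..u s, g r) := by
    have h1 := h.continuous_primitive.comp hu.sol.continuous
    have h2 := hu.sol.continuous
    have h3 := hu.sol.continuous_deriv
    have h4 := h.continuous
    exact ((h3.pow 2).div_const 2).neg.add ((h2.mul (h4.comp h2)).sub h1)
  have e : action g p u u' a b + α ^ 2 / 24 * (b - a) ^ 3 = ∫ s in a..b,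
      (-(u' s ^ 2 / 2) + (u s * g (u s) - ∫ r in (0 : ℝ)..u s, g r)
        + (α * ((a + b) / 2 - s)) ^ 2 / 2) := by
    rw [h.action_eq hu.sol hu.left hu.right, ← hint, ← intervalIntegral.integral_add
      (c1.intervalIntegrable _ _) (by apply Continuous.intervalIntegrable; fun_prop)]
  have hbd := intervalIntegral.norm_integral_le_of_norm_le_const (a := a) (b := b)
    (f := fun s => -(u' s ^ 2 / 2) + (u s * g (u s) - ∫ r in (0 : ℝ)..u s, g r)
        + (α * ((a + b) / 2 - s)) ^ 2 / 2) (C := ε * (b - a) ^ 2) fun s hs => by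
      rw [uIoc_of_le hab'] at hs
      have hs' := Ioc_subset_Icc_self hs
      obtain ⟨v1, v2⟩ := hvir (u s) (hu.nonneg hα hη1 hs')
      have hup := hu.upper hα hη1 hs'
      have h1 : ε / (3 * α) * u s ≤ ε / 3 * (b - a) ^ 2 := by
        have := mul_le_mul_of_nonneg_left hup (by positivity : 0 ≤ ε / (3 * α))
        refine this.trans (le_of_eq ?_)
        field_simp
      have hd := hu.deriv_le s hs'
      have hdu := hu.abs_deriv_le hα hη1 hs'
      have hpar : |α * ((a + b) / 2 - s)| ≤ α * (b - a) := by
        rw [abs_mul, abs_of_pos hα]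
        exact mul_le_mul_of_nonneg_left
          (abs_le.mpr ⟨by linarith [hs'.1, hs'.2], by linarith [hs'.1, hs'.2]⟩) hα.le
      have h2 : |(u' s - α * ((a + b) / 2 - s)) * ((u' s + α * ((a + b) / 2 - s)) / 2)|
          ≤ η * (b - a) * (α * (b - a)) := by
        rw [abs_mul]
        refine mul_le_mul hd ?_ (abs_nonneg _) (by positivity)
        rw [abs_div, abs_two]
        linarith [abs_add_le (u' s) (α * ((a + b) / 2 - s))]
      have h3 : η * (b - a) * (α * (b - a)) ≤ ε / 3 * (b - a) ^ 2 := by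
        have := mul_le_mul_of_nonneg_right hη2 (sq_nonneg (b - a))
        linarith
      have h4 := abs_le.mp h2
      have h5 : (u' s - α * ((a + b) / 2 - s)) * ((u' s + α * ((a + b) / 2 - s)) / 2)
        = u' s ^ 2 / 2 - (α * ((a + b) / 2 - s)) ^ 2 / 2 := by ring
      rw [h5] at h4
      exact abs_le.mpr ⟨by linarith [h4.2], by linarith [h4.1]⟩
  rw [← e, Real.norm_eq_abs, abs_of_nonneg (by linarith : 0 ≤ b - a)] at hbd
  rw [← abs_neg, show -(-action g p u u' a b - α ^ 2 / 24 * (b - a) ^ 3)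
    = action g p u u' a b + α ^ 2 / 24 * (b - a) ^ 3 by ring]
  exact hbd.trans (le_of_eq (by ring))

/-- A family of arcs together with the properties of its action. -/
theorem exists_arc_family (h : IsNormalized g g' p M α K) {ε : ℝ} (hε : 0 < ε) :
    ∃ η ≤ α / 8, ∃ τ > 0, ∃ U U' : ℝ → ℝ → ℝ → ℝ,
      (∀ a b, τ ≤ b - a → IsArc g p α η a b (U a b) (U' a b)) ∧
      (∀ a b, τ ≤ b - a →
        |-action g p (U a b) (U' a b) a b - α ^ 2 / 24 * (b - a) ^ 3| ≤ ε * (b - a) ^ 3) ∧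
      ContinuousOn (fun q : ℝ × ℝ => -action g p (U q.1 q.2) (U' q.1 q.2) q.1 q.2)
        {q | τ ≤ q.2 - q.1} ∧
      ∀ a b, τ < b - a →
        HasDerivAt (fun s => -action g p (U a s) (U' a s) a s) (U' a b b ^ 2 / 2) b ∧
        HasDerivAt (fun s => -action g p (U s b) (U' s b) s b) (-(U' a b a ^ 2 / 2)) a := by
  obtain ⟨η, hη, hηα, τ₁, hτ₁, hest⟩ := h.exists_action_estimate hε
  obtain ⟨τ₂, hτ₂, hex⟩ := h.exists_arc hη hηα
  obtain ⟨τ₃, hτ₃, hexp⟩ := h.exists_action_expansion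
  -- No regularity in the endpoints is imposed on the selection: the expansion of the action holds
  -- for any two arcs with nearby endpoints.
  choose! U U' hU using hex
  set τ := τ₁ + τ₂ + τ₃ with hτ
  have hU' : ∀ a b, τ ≤ b - a → IsArc g p α η a b (U a b) (U' a b) := fun a b hab =>
    hU a b (by linarith)
  refine ⟨η, hηα, τ, by positivity, U, U', hU', fun a b hab => hest a b (by linarith) _ _
    (hU' a b hab), ?_, ?_⟩
  · rintro ⟨a, b⟩ hab
    have hab : τ ≤ b - a := hab
    obtain ⟨C, δ₀, hδ₀, hC⟩ := hexp η hηα a b (by linarith)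
    set A := U' a b a ^ 2 / 2 + U' a b b ^ 2 / 2 with hA
    have hA1 : 0 ≤ U' a b a ^ 2 / 2 := by positivity
    have hA2 : 0 ≤ U' a b b ^ 2 / 2 := by positivity
    refine tendsto_iff_dist_tendsto_zero.mpr ?_
    have hlim : Tendsto (fun q : ℝ × ℝ => A * dist q (a, b) + C * dist q (a, b) ^ 2)
        (𝓝[{q | τ ≤ q.2 - q.1}] (a, b)) (𝓝 0) := by
      have hc : Continuous fun q : ℝ × ℝ => A * dist q (a, b) + C * dist q (a, b) ^ 2 := by fun_prop
      have := (hc.tendsto (a, b)).mono_left (nhdsWithin_le_nhds (s := {q | τ ≤ q.2 - q.1}))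
      simpa using this
    refine squeeze_zero' (Eventually.of_forall fun _ => dist_nonneg) ?_ hlim
    filter_upwards [self_mem_nhdsWithin,
      mem_nhdsWithin_of_mem_nhds (Metric.closedBall_mem_nhds (a, b) hδ₀)] with q hq hqδ
    have d1 : |q.1 - a| ≤ dist q (a, b) := by
      rw [← Real.dist_eq]; exact le_max_left _ _
    have d2 : |q.2 - b| ≤ dist q (a, b) := by
      rw [← Real.dist_eq]; exact le_max_right _ _
    have := hC q.1 q.2 (dist q (a, b)) d1 d2 hqδ _ _ _ _ (hU' a b hab) (hU' q.1 q.2 hq)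
    have h1 := abs_le.mp this
    have h2 := abs_le.mp d1
    have h3 := abs_le.mp d2
    have m1 := mul_le_mul_of_nonneg_left h2.1 hA1
    have m2 := mul_le_mul_of_nonneg_left h2.2 hA1
    have m3 := mul_le_mul_of_nonneg_left h3.1 hA2
    have m4 := mul_le_mul_of_nonneg_left h3.2 hA2
    rw [Real.dist_eq, hA]
    exact abs_le.mpr ⟨by linarith [h1.2], by linarith [h1.1]⟩
  · intro a b hab
    obtain ⟨C, δ₀, hδ₀, hC⟩ := hexp η hηα a b (by linarith)
    constructor
    · refine hasDerivAt_of_abs_sub_le_sq (C := C) ?_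
      filter_upwards [Metric.closedBall_mem_nhds b hδ₀,
        lt_mem_nhds (show a + τ < b by linarith)] with s hs hsτ
      rw [Metric.mem_closedBall, Real.dist_eq] at hs
      have := hC a s |s - b| (by simp) le_rfl hs _ _ _ _ (hU' a b hab.le)
        (hU' a s (by linarith))
      rw [sq_abs, ← abs_neg] at this
      refine le_trans (le_of_eq ?_) this
      congr 1; ring
    · refine hasDerivAt_of_abs_sub_le_sq (C := C) ?_
      filter_upwards [Metric.closedBall_mem_nhds a hδ₀,
        gt_mem_nhds (show a < b - τ by linarith)] with s hs hsτ
      rw [Metric.mem_closedBall, Real.dist_eq] at hs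
      have := hC s b |s - a| le_rfl (by simp) hs _ _ _ _ (hU' a b hab.le)
        (hU' s b (by linarith))
      rw [sq_abs, ← abs_neg] at this
      refine le_trans (le_of_eq ?_) this
      congr 1; ring

end IsNormalized

/-! ### Gluing arcs of alternating sign -/

/-- The sign `1` or `-1` attached to a boolean. -/
def boolSign (e : Bool) : ℝ := cond e (-1) 1

lemma boolSign_mul_self (e : Bool) : boolSign e * boolSign e = 1 := by
  cases e <;> simp [boolSign]

lemma boolSign_not (e : Bool) : boolSign (!e) = -boolSign e := by
  cases e <;> simp [boolSign]

lemma abs_boolSign_mul (e : Bool) (x : ℝ) : |boolSign e * x| = |x| := by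
  cases e <;> simp [boolSign]

lemma IsSecondOrderSol.of_boolSign {g p u u' : ℝ → ℝ} {e : Bool}
    (h : IsSecondOrderSol (fun t x => boolSign e * p t - boolSign e * g (boolSign e * x)) u u') :
    IsSecondOrderSol (fun t x => p t - g x) (fun t => boolSign e * u t)
      (fun t => boolSign e * u' t) := fun t =>
  ⟨(h t).1.const_mul _, ((h t).2.const_mul _).congr_deriv (by
    rw [mul_sub, ← mul_assoc, ← mul_assoc, boolSign_mul_self, one_mul, one_mul])⟩

lemma exists_gap_of_mem {t : ℕ → ℝ} {s : ℝ} {n : ℕ} (h0 : t 0 ≤ s) (hn : s < t n) :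
    ∃ k < n, t k ≤ s ∧ s < t (k + 1) := by
  induction n with
  | zero => linarith
  | succ n ih =>
    rcases lt_or_ge s (t n) with h | h
    · obtain ⟨k, hk, hks⟩ := ih h
      exact ⟨k, by omega, hks⟩
    · exact ⟨n, by omega, h, hn⟩

/-- `g` and its reflection both satisfy the hypotheses of the normalised equation. -/
def IsBiNormalized (g g' p : ℝ → ℝ) (M : ℝ) (α : Bool → ℝ) (K : NNReal) : Prop :=
  ∀ e, IsNormalized (fun x => boolSign e * g (boolSign e * x)) (fun x => g' (boolSign e * x))
    (fun t => boolSign e * p t) M (α e) K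

namespace IsBiNormalized

variable {g g' p : ℝ → ℝ} {M : ℝ} {α : Bool → ℝ} {K : NNReal}

/-- Oscillating solutions on large bounded intervals, with uniform estimates. -/
theorem exists_oscillating_on_interval (h : IsBiNormalized g g' p M α K) (N : ℝ) :
    ∃ H > N, ∃ B W : ℝ, 0 < H ∧ 0 < W ∧ ∀ L, W < L → ∃ v v' : ℝ → ℝ,
      IsSecondOrderSol (fun t x => p t - g x) v v' ∧
      (∀ s, -L ≤ s → s < L → |v s| ≤ B ∧ |v' s| ≤ B) ∧
      ∀ s, -L ≤ s → s + W < L →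
        (∃ t ∈ Icc s (s + W), H ≤ v t) ∧ ∃ t ∈ Icc s (s + W), v t ≤ -H := by
  have hα : ∀ e, 0 < α e := fun e => (h e).pos
  set c₁ : Bool → ℝ := fun e => α e ^ 2 / 24 with hc₁
  have hc₁0 : ∀ e, 0 < c₁ e := fun e => by have := hα e; simp only [hc₁]; positivity
  set α₀ := min (α false) (α true) with hα₀
  have hα₀0 : 0 < α₀ := lt_min (hα _) (hα _)
  have hα₀le : ∀ e, α₀ ≤ α e := fun e => by cases e <;> simp [hα₀]
  set α₁ := max (α false) (α true) with hα₁
  have hα₁le : ∀ e, α e ≤ α₁ := fun e => by cases e <;> simp [hα₁]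
  have hα₁0 : 0 < α₁ := (hα false).trans_le (hα₁le _)
  obtain ⟨ε, hε, Λ, hΛ, hchain⟩ := exists_critical_subdivision
    (c₀ := min (c₁ false) (c₁ true)) (C := max (c₁ false) (c₁ true))
    (lt_min (hc₁0 _) (hc₁0 _)) ((min_le_left _ _).trans (le_max_left _ _))
  choose η hη τ₀ hτ₀ U U' hU hest hcont hder using fun e => (h e).exists_arc_family hε
  set τ := τ₀ false + τ₀ true + 1 + 16 * |N| / α₀ with hτ
  have hN0 : 0 ≤ 16 * |N| / α₀ := by positivity
  have hττ : ∀ e, τ₀ e ≤ τ := fun e => by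
    have h1 := hτ₀ false; have h2 := hτ₀ true
    cases e <;> linarith
  -- The summand `16 * |N| / α₀` in `τ` is there for the height: at its midpoint an arc longer than
  -- `τ` is at least `α₀ / 16 * τ ^ 2` high.
  have hτ1 : 1 < τ := by linarith [hτ₀ false, hτ₀ true]
  have hτ0 : 0 < τ := by linarith
  set H := α₀ / 16 * τ ^ 2 with hH
  have hHN : N < H := by
    have h1 : 16 * |N| / α₀ < τ := by linarith [hτ₀ false, hτ₀ true]
    have h2 : τ ≤ τ ^ 2 := by nlinarith
    have h3 : 16 * |N| / α₀ < τ ^ 2 := h1.trans_le h2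
    rw [div_lt_iff₀ hα₀0] at h3
    have := le_abs_self N
    rw [hH]; linarith
  set B := α₁ * (Λ * τ) ^ 2 + α₁ * (Λ * τ) with hB
  -- A window of length three maximal gaps contains, after the gap in which it starts, two complete
  -- arcs, one of each sign.
  refine ⟨H, hHN, B, 3 * (Λ * τ), by positivity, by positivity, fun L hL => ?_⟩
  have hΛτ : 0 < Λ * τ := mul_pos hΛ hτ0
  set f : ℕ → ℝ → ℝ → ℝ := fun k a b =>
    -action (fun x => boolSign k.bodd * g (boolSign k.bodd * x)) (fun t => boolSign k.bodd * p t)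
      (U k.bodd a b) (U' k.bodd a b) a b with hf
  obtain ⟨n, t, ht0, htn, hgap, hmin⟩ := hchain (fun k => c₁ k.bodd) f τ hτ0
    (fun k => by
      cases k.bodd
      · exact ⟨min_le_left _ _, le_max_left _ _⟩
      · exact ⟨min_le_right _ _, le_max_right _ _⟩)
    (fun k => by simp only [hf, Nat.bodd_succ, Bool.not_not])
    (fun k a b hab => hest _ a b ((hττ _).trans hab))
    (fun k => (hcont k.bodd).mono fun q hq => (hττ _).trans hq) (-L) L (by linarith)
  have harc : ∀ k < n, IsArc (fun x => boolSign k.bodd * g (boolSign k.bodd * x))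
      (fun t => boolSign k.bodd * p t) (α k.bodd) (η k.bodd) (t k) (t (k + 1))
      (U k.bodd (t k) (t (k + 1))) (U' k.bodd (t k) (t (k + 1))) := fun k hk =>
    hU _ _ _ ((hττ _).trans (hgap k hk).1.le)
  set v : ℕ → ℝ → ℝ := fun k s => boolSign k.bodd * U k.bodd (t k) (t (k + 1)) s with hv
  set v' : ℕ → ℝ → ℝ := fun k s => boolSign k.bodd * U' k.bodd (t k) (t (k + 1)) s with hv'
  have hsol : ∀ k < n, IsSecondOrderSol (fun t x => p t - g x) (v k) (v' k) := fun k hk =>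
    (harc k hk).sol.of_boolSign
  have hlip : LipschitzWith K g := by simpa [boolSign] using (h false).lip
  have hstep : ∀ k, k + 1 < n → v (k + 1) = v k ∧ v' (k + 1) = v' k := by
    intro k hk
    have a0 := harc k (by omega)
    have a1 := harc (k + 1) hk
    have g0 := (hgap k (by omega)).1
    have g1 := (hgap (k + 1) hk).1
    have d0 := (hder k.bodd (t k) (t (k + 1)) (by linarith [hττ k.bodd])).1
    have d1 := (hder (k + 1).bodd (t (k + 1)) (t (k + 2)) (by
      have := hττ (k + 1).bodd
      have : τ < t (k + 2) - t (k + 1) := g1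
      linarith)).2
    -- Criticality of the node equates the squares of the two slopes of the unsigned arcs. One is
    -- negative and the other positive, so they are opposite, and the alternating signs make the
    -- velocities agree; uniqueness then identifies the two global solutions.
    have hz := (hmin k hk).hasDerivAt_eq_zero (d0.add d1)
    have p0 := a0.deriv_right_neg (hα _) (hη _) (by linarith)
    have p1 := a1.deriv_left_pos (hα _) (hη _) (by linarith)
    have hslope : U' (k + 1).bodd (t (k + 1)) (t (k + 2)) (t (k + 1))
        = -U' k.bodd (t k) (t (k + 1)) (t (k + 1)) := by
      have p1' : 0 < U' (k + 1).bodd (t (k + 1)) (t (k + 2)) (t (k + 1)) := p1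
      rw [← abs_of_pos p1', ← abs_of_neg p0, ← sq_eq_sq_iff_abs_eq_abs]
      linarith
    refine (hsol (k + 1) hk).eq_of_eq (fun t => hlip.const_sub_real (p t)) (hsol k (by omega))
      (t₀ := t (k + 1)) ?_ ?_
    · have e0 := a0.right
      have e1 := a1.left
      simp only [hv, e0, e1, mul_zero]
    · have : U' (k + 1).bodd (t (k + 1)) (t (k + 1 + 1)) (t (k + 1))
        = -U' k.bodd (t k) (t (k + 1)) (t (k + 1)) := hslope
      change boolSign (k + 1).bodd * U' (k + 1).bodd (t (k + 1)) (t (k + 1 + 1)) (t (k + 1))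
        = boolSign k.bodd * U' k.bodd (t k) (t (k + 1)) (t (k + 1))
      rw [this, Nat.bodd_succ, boolSign_not, neg_mul_neg]
  have hall : ∀ k < n, v k = v 0 ∧ v' k = v' 0 := by
    intro k
    induction k with
    | zero => exact fun _ => ⟨rfl, rfl⟩
    | succ k ih =>
      intro hk
      obtain ⟨e1, e2⟩ := hstep k hk
      obtain ⟨e3, e4⟩ := ih (by omega)
      exact ⟨e1.trans e3, e2.trans e4⟩
  have hn0 : 0 < n := by
    rcases Nat.eq_zero_or_pos n with rfl | hn
    · linarith
    · exact hn
  have hmid : ∀ k < n, ∃ m ∈ Icc (t k) (t (k + 1)), H ≤ boolSign k.bodd * v 0 m := by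
    intro k hk
    obtain ⟨g0, -⟩ := hgap k hk
    have hm : (t k + t (k + 1)) / 2 ∈ Icc (t k) (t (k + 1)) := ⟨by linarith, by linarith⟩
    refine ⟨_, hm, ?_⟩
    have hlow := (harc k hk).lower (hα _) (hη _) hm
    rw [← (hall k hk).1]
    simp only [hv, ← mul_assoc, boolSign_mul_self, one_mul]
    refine le_trans ?_ hlow
    rw [show (t k + t (k + 1)) / 2 - t k = (t (k + 1) - t k) / 2 by ring,
      show t (k + 1) - (t k + t (k + 1)) / 2 = (t (k + 1) - t k) / 2 by ring, min_self]
    have h1 : τ ^ 2 ≤ (t (k + 1) - t k) ^ 2 := by gcongr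
    have h2 : α₀ * τ ^ 2 ≤ α k.bodd * (t (k + 1) - t k) ^ 2 :=
      mul_le_mul (hα₀le _) h1 (by positivity) (hα _).le
    rw [hH]
    linarith
  refine ⟨v 0, v' 0, hsol 0 hn0, fun s hs hsL => ?_, fun s hs hsW => ?_⟩
  · obtain ⟨k, hk, hks⟩ := exists_gap_of_mem (t := t) (n := n) (s := s) (by rwa [ht0])
      (by rwa [htn])
    have hs' : s ∈ Icc (t k) (t (k + 1)) := ⟨hks.1, hks.2.le⟩
    obtain ⟨g0, g1⟩ := hgap k hk
    have ha := harc k hk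
    have b1 := ha.upper (hα _) (hη _) hs'
    have b2 := ha.abs_deriv_le (hα _) (hη _) hs'
    have b0 := ha.nonneg (hα _) (hη _) hs'
    have hαk := hα k.bodd
    have c1 : α k.bodd * (t (k + 1) - t k) ^ 2 ≤ α₁ * (Λ * τ) ^ 2 :=
      mul_le_mul (hα₁le _) (pow_le_pow_left₀ (by linarith) g1 2) (by positivity) hα₁0.le
    have c2 : α k.bodd * (t (k + 1) - t k) ≤ α₁ * (Λ * τ) :=
      mul_le_mul (hα₁le _) g1 (by linarith) hα₁0.le
    have c3 : 0 ≤ α₁ * (Λ * τ) ^ 2 := by positivity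
    have c4 : 0 ≤ α₁ * (Λ * τ) := by positivity
    rw [← (hall k hk).1, ← (hall k hk).2]
    simp only [hv, hv', abs_boolSign_mul, abs_of_nonneg b0]
    exact ⟨by linarith, by linarith⟩
  · obtain ⟨k, hk, hks⟩ := exists_gap_of_mem (t := t) (n := n) (s := s) (by rwa [ht0])
      (by rw [htn]; linarith)
    have hk1 : k + 1 < n := by
      by_contra! hlt
      have hkn : k + 1 = n := by omega
      have := (hgap k hk).2
      rw [hkn, htn] at this
      linarith
    have g0 := hgap k hk
    have g1 := hgap (k + 1) hk1
    have hk2 : k + 2 < n := by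
      by_contra! hlt
      have hkn : k + 1 + 1 = n := by omega
      have := g1.2
      rw [hkn, htn] at this
      linarith [g0.2]
    have g2 := hgap (k + 2) hk2
    obtain ⟨m1, hm1, hv1⟩ := hmid (k + 1) hk1
    obtain ⟨m2, hm2, hv2⟩ := hmid (k + 2) hk2
    have i1 : m1 ∈ Icc s (s + 3 * (Λ * τ)) :=
      ⟨by linarith [hm1.1], by linarith [hm1.2, g0.2, g1.2]⟩
    have i2 : m2 ∈ Icc s (s + 3 * (Λ * τ)) := by
      have e1 : τ < t (k + 2) - t (k + 1) := g1.1
      have e2 : t (k + 2) - t (k + 1) ≤ Λ * τ := g1.2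
      exact ⟨by linarith [hm2.1], by linarith [hm2.2, g0.2, g2.2]⟩
    rw [Nat.bodd_succ] at hv1
    rw [Nat.bodd_succ, Nat.bodd_succ, Bool.not_not] at hv2
    rw [boolSign_not] at hv1
    cases hb : k.bodd
    · rw [hb] at hv1 hv2
      simp only [boolSign, cond_false, neg_mul, one_mul] at hv1 hv2
      exact ⟨⟨m2, i2, hv2⟩, m1, i1, by linarith⟩
    · rw [hb] at hv1 hv2
      simp only [boolSign, cond_true, neg_neg, neg_mul, one_mul] at hv1 hv2
      exact ⟨⟨m1, i1, hv1⟩, m2, i2, by linarith⟩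

/-- Large oscillating solutions on the whole line. -/
theorem exists_oscillating (h : IsBiNormalized g g' p M α K) (N : ℝ) :
    ∃ H > N, 0 < H ∧ ∃ B W : ℝ, 0 < W ∧ ∃ v v' : ℝ → ℝ,
      IsSecondOrderSol (fun t x => p t - g x) v v' ∧ (∀ s, |v s| ≤ B ∧ |v' s| ≤ B) ∧
      ∀ s, (∃ t ∈ Icc s (s + W), H ≤ v t) ∧ ∃ t ∈ Icc s (s + W), v t ≤ -H := by
  -- Twice `|N|`, because half of the amplitude is given up in the passage to the limit.
  obtain ⟨H, hHN, B, W, hH, hW, hex⟩ := h.exists_oscillating_on_interval (2 * |N|)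
  have hlip : LipschitzWith K g := by simpa [boolSign] using (h false).lip
  have hpc : Continuous p := by simpa [boolSign] using (h false).p_cont
  have hFL : ∀ t, LipschitzWith K fun x => p t - g x := fun t => hlip.const_sub_real (p t)
  have hFb : ∀ t x, |p t - g x| ≤ 2 * M := fun t x => by
    have h1 : |p t| ≤ M := by simpa [boolSign] using (h false).p_bdd t
    have h2 : |g x| ≤ M := by simpa [boolSign] using (h false).bdd x
    exact (abs_sub _ _).trans (by linarith)
  choose! v v' hv hvB hvW using fun (n : ℕ) => hex (W + 1 + n) (by
    have : (0 : ℝ) ≤ n := n.cast_nonneg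
    linarith)
  have hB0 : ∀ n, (v n 0, v' n 0) ∈ Icc (-B) B ×ˢ Icc (-B) B := fun n => by
    have hn : (0 : ℝ) ≤ n := n.cast_nonneg
    obtain ⟨h1, h2⟩ := hvB n 0 (by linarith) (by linarith)
    exact ⟨abs_le.mp h1, abs_le.mp h2⟩
  -- Compactness of the data at time `0` is enough: continuous dependence turns it into convergence
  -- that is uniform on bounded windows.
  obtain ⟨⟨x, y⟩, -, φ, hφ, hlim⟩ := (isCompact_Icc.prod isCompact_Icc).tendsto_subseq hB0
  obtain ⟨w, w', hw, hw0, hw'0⟩ := IsSecondOrderSol.exists_global (F := fun t x => p t - g x)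
    (fun x => by fun_prop) hFL hFb 0 x y
  have hdist : Tendsto (fun n => dist (v (φ n) 0, v' (φ n) 0) (x, y)) atTop (𝓝 0) :=
    tendsto_iff_dist_tendsto_zero.mp hlim
  have hclose : ∀ n t, |v (φ n) t - w t| ≤ dist (v (φ n) 0, v' (φ n) 0) (x, y)
        * Real.exp (max 1 K * |t|) ∧ |v' (φ n) t - w' t|
        ≤ dist (v (φ n) 0, v' (φ n) 0) (x, y) * Real.exp (max 1 K * |t|) := by
    intro n t
    have := (hv (φ n)).dist_le hFL hw (t₀ := 0) (δ := dist (v (φ n) 0, v' (φ n) 0) (x, y))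
      (by rw [hw0, ← Real.dist_eq]; exact le_max_left _ _)
      (by rw [hw'0, ← Real.dist_eq]; exact le_max_right _ _) t
    rwa [sub_zero] at this
  have hlarge : ∀ R : ℝ, ∀ᶠ n in atTop, R ≤ (φ n : ℝ) := fun R =>
    (tendsto_natCast_atTop_atTop.comp hφ.tendsto_atTop).eventually_ge_atTop R
  have hptw : ∀ t, Tendsto (fun n => v (φ n) t) atTop (𝓝 (w t)) ∧
      Tendsto (fun n => v' (φ n) t) atTop (𝓝 (w' t)) := by
    intro t
    have h0 : Tendsto (fun n => dist (v (φ n) 0, v' (φ n) 0) (x, y) * Real.exp (max 1 K * |t|))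
        atTop (𝓝 0) := by simpa using hdist.mul_const (Real.exp (max 1 K * |t|))
    exact ⟨tendsto_iff_dist_tendsto_zero.mpr (squeeze_zero (fun _ => dist_nonneg)
      (fun n => (hclose n t).1) h0), tendsto_iff_dist_tendsto_zero.mpr
      (squeeze_zero (fun _ => dist_nonneg) (fun n => (hclose n t).2) h0)⟩
  refine ⟨H / 2, by linarith [le_abs_self N], by linarith, B, W, hW, w, w', hw, fun s => ?_,
    fun s => ?_⟩
  · have hev : ∀ᶠ n in atTop, |v (φ n) s| ≤ B ∧ |v' (φ n) s| ≤ B := by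
      filter_upwards [hlarge |s|] with n hn
      exact hvB (φ n) s (by linarith [neg_abs_le s]) (by linarith [le_abs_self s])
    exact ⟨le_of_tendsto (hptw s).1.abs (hev.mono fun _ => And.left),
      le_of_tendsto (hptw s).2.abs (hev.mono fun _ => And.right)⟩
  · set E := Real.exp (max 1 K * (|s| + W)) with hE
    have hsmall : ∀ᶠ n in atTop, dist (v (φ n) 0, v' (φ n) 0) (x, y) * E < H / 2 := by
      have h0 : Tendsto (fun n => dist (v (φ n) 0, v' (φ n) 0) (x, y) * E) atTop (𝓝 0) := by
        simpa using hdist.mul_const E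
      exact h0.eventually (gt_mem_nhds (by linarith))
    obtain ⟨n, hn1, hn2⟩ := (hsmall.and (hlarge |s|)).exists
    have hwin : ∀ t ∈ Icc s (s + W), |v (φ n) t - w t| ≤ H / 2 := by
      intro t ht
      refine (hclose n t).1.trans (le_trans (mul_le_mul_of_nonneg_left ?_ dist_nonneg) hn1.le)
      refine Real.exp_le_exp.mpr (mul_le_mul_of_nonneg_left ?_ (by positivity))
      exact abs_le.mpr ⟨by linarith [neg_abs_le s, ht.1], by linarith [le_abs_self s, ht.2]⟩
    obtain ⟨⟨t1, ht1, hv1⟩, t2, ht2, hv2⟩ := hvW (φ n) s (by linarith [neg_abs_le s])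
      (by linarith [le_abs_self s])
    exact ⟨⟨t1, ht1, by linarith [(abs_le.mp (hwin t1 ht1)).2]⟩,
      t2, ht2, by linarith [(abs_le.mp (hwin t2 ht2)).1]⟩

end IsBiNormalized

/-! ### The original equation: levels, necessity and normalisation -/

/-- A function which is unbounded in both directions on all windows of some fixed length takes
each intermediate value infinitely often. -/
lemma infinite_setOf_eq_of_oscillating {v : ℝ → ℝ} (hv : Continuous v) {H W : ℝ}
    (h : ∀ s, (∃ t ∈ Icc s (s + W), H ≤ v t) ∧ ∃ t ∈ Icc s (s + W), v t ≤ -H) {y : ℝ}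
    (hy : |y| ≤ H) : {t | v t = y}.Infinite := by
  refine Set.infinite_of_not_bddAbove fun ⟨b, hb⟩ => ?_
  obtain ⟨⟨t₁, ht₁, h₁⟩, t₂, ht₂, h₂⟩ := h (b + 1)
  obtain ⟨t, ht, hty⟩ := intermediate_value_uIcc (a := t₂) (b := t₁) hv.continuousOn
    (mem_uIcc_of_le (h₂.trans (abs_le.mp hy).1) ((abs_le.mp hy).2.trans h₁))
  have h3 : t ≤ b := hb hty
  have h4 := uIcc_subset_Icc ht₂ ht₁ ht
  linarith [h4.1]

lemma IsSecondOrderSol.isSolution {g p u u' : ℝ → ℝ} (hg : Continuous g) (hp : Continuous p)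
    (h : IsSecondOrderSol (fun t x => p t - g x) u u') : IsSolution g p u := by
  have d1 : deriv u = u' := funext fun t => (h t).1.deriv
  have d2 : deriv u' = fun t => p t - g (u t) := funext fun t => (h t).2.deriv
  refine ⟨?_, fun t => by rw [d1, d2]; ring⟩
  have hc := h.continuous
  rw [show (2 : WithTop ℕ∞) = 1 + 1 from rfl, contDiff_succ_iff_deriv, d1, contDiff_one_iff_deriv, d2]
  refine ⟨fun t => (h t).1.differentiableAt, fun h => by simp at h,
    fun t => (h t).2.differentiableAt, by fun_prop⟩

lemma IsSolution.isSecondOrderSol {g p u : ℝ → ℝ} (h : IsSolution g p u) :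
    IsSecondOrderSol (fun t x => p t - g x) u (deriv u) := by
  have h1 := h.1
  rw [show (2 : WithTop ℕ∞) = 1 + 1 from rfl, contDiff_succ_iff_deriv, contDiff_one_iff_deriv] at h1
  exact fun t => ⟨(h1.1 t).hasDerivAt, (h1.2.2.1 t).hasDerivAt.congr_deriv (by linarith [h.2 t])⟩

/-- A bounded solution forces the asymptotic average into the range of `g`. -/
theorem IsSolution.average_mem_Ioo {g p u : ℝ → ℝ} {gm gp A : ℝ} (hg : Continuous g)
    (hgb : IsBoundedFun g) (hgmono : StrictMono g) (hgm : Tendsto g atBot (𝓝 gm))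
    (hgp : Tendsto g atTop (𝓝 gp)) (hp : Continuous p) (hpb : IsBoundedFun p)
    (hA : HasAsymptoticAverage p A) (hu : IsSolution g p u) (hub : IsBoundedFun u) :
    gm < A ∧ A < gp := by
  obtain ⟨Mg, hMg⟩ := hgb
  obtain ⟨Mp, hMp⟩ := hpb
  obtain ⟨M, hM⟩ := hub
  have hs := hu.isSecondOrderSol
  have hacc : ∀ t, |p t - g (u t)| ≤ Mp + Mg := fun t =>
    (abs_sub _ _).trans (add_le_add (hMp t) (hMg (u t)))
  -- the derivative is bounded
  have hd : ∀ t, |deriv u t| ≤ 2 * M + (Mp + Mg) := by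
    intro t
    obtain ⟨ξ, hξ, he⟩ := exists_hasDerivAt_eq_slope u (deriv u) (show t < t + 1 by linarith)
      hs.continuous.continuousOn fun x _ => (hs x).1
    rw [add_sub_cancel_left, div_one] at he
    have h1 : |deriv u t - deriv u ξ| ≤ (Mp + Mg) * |t - ξ| :=
      convex_univ.norm_image_sub_le_of_norm_hasDerivWithin_le
        (fun x _ => (hs x).2.hasDerivWithinAt) (fun x _ => hacc x) (mem_univ ξ) (mem_univ t)
    have h2 : |t - ξ| ≤ 1 := abs_le.mpr ⟨by linarith [hξ.2], by linarith [hξ.1]⟩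
    have h3 := mul_le_mul_of_nonneg_left h2 ((abs_nonneg _).trans (hacc 0))
    have h4 : |deriv u ξ| ≤ 2 * M := by
      rw [he]
      exact (abs_sub _ _).trans (by linarith [hM t, hM (t + 1)])
    have h5 := abs_add_le (deriv u t - deriv u ξ) (deriv u ξ)
    rw [sub_add_cancel] at h5
    linarith
  set D := 2 * (2 * M + (Mp + Mg)) with hD
  have hmean : Tendsto (fun T : ℝ => (1 / T) * ∫ s in (0 : ℝ)..T, p s) atTop (𝓝 A) := by
    have := hA.tendsto_at 0
    simpa using this
  have hDlim : Tendsto (fun T : ℝ => D / T) atTop (𝓝 0) := tendsto_const_nhds.div_atTop tendsto_id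
  have hgu : Continuous fun s => g (u s) := hg.comp hs.continuous
  -- The difference of the integrals is `u' T - u' 0`, bounded independently of `T`, so the means of
  -- `p` and `g(u)` have the same limit.
  have hbal : ∀ T : ℝ, |(∫ s in (0 : ℝ)..T, p s) - ∫ s in (0 : ℝ)..T, g (u s)| ≤ D := by
    intro T
    rw [← intervalIntegral.integral_sub (hp.intervalIntegrable _ _) (hgu.intervalIntegrable _ _),
      intervalIntegral.integral_eq_sub_of_hasDerivAt (fun s _ => (hs s).2)
        ((hp.sub hgu).intervalIntegrable _ _)]
    exact (abs_sub _ _).trans (by linarith [hd T, hd 0])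
  have hlow : g (-M) ≤ A := by
    have h1 : Tendsto (fun T : ℝ => g (-M) - D / T) atTop (𝓝 (g (-M) - 0)) :=
      tendsto_const_nhds.sub hDlim
    rw [sub_zero] at h1
    refine le_of_tendsto_of_tendsto h1 hmean ?_
    filter_upwards [eventually_gt_atTop 0] with T hT
    have h2 := intervalIntegral.integral_mono_on (f := fun _ => g (-M)) hT.le (by simp)
      (hgu.intervalIntegrable (μ := MeasureTheory.volume) _ _)
      fun s _ => hgmono.monotone (abs_le.mp (hM s)).1
    rw [intervalIntegral.integral_const, smul_eq_mul, sub_zero] at h2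
    have h3 := (abs_le.mp (hbal T)).1
    rw [one_div, ← div_eq_inv_mul, le_div_iff₀ hT, sub_mul, div_mul_cancel₀ _ hT.ne']
    linarith
  have hup : A ≤ g M := by
    have h1 : Tendsto (fun T : ℝ => g M + D / T) atTop (𝓝 (g M + 0)) :=
      tendsto_const_nhds.add hDlim
    rw [add_zero] at h1
    refine le_of_tendsto_of_tendsto hmean h1 ?_
    filter_upwards [eventually_gt_atTop 0] with T hT
    have h2 := intervalIntegral.integral_mono_on (g := fun _ => g M) hT.le
      (hgu.intervalIntegrable (μ := MeasureTheory.volume) _ _) (by simp)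
      fun s _ => hgmono.monotone (abs_le.mp (hM s)).2
    rw [intervalIntegral.integral_const, smul_eq_mul, sub_zero] at h2
    have h3 := (abs_le.mp (hbal T)).2
    rw [one_div, ← div_eq_inv_mul, div_le_iff₀ hT, add_mul, div_mul_cancel₀ _ hT.ne']
    linarith
  -- Strictness comes from one more unit: `gm ≤ g (-M - 1) < g (-M) ≤ A`, and similarly above.
  have h1 := hgmono.monotone.le_of_tendsto hgm (-M - 1)
  have h2 := hgmono.monotone.ge_of_tendsto hgp (M + 1)
  have h3 : g (-M - 1) < g (-M) := hgmono (by linarith)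
  have h4 : g M < g (M + 1) := hgmono (by linarith)
  exact ⟨by linarith, by linarith⟩

/-- A bounded strictly increasing function is not convex on a right half-line. -/
lemma not_convexOn_Ici_of_bounded {g : ℝ → ℝ} {x₀ : ℝ} (hgb : IsBoundedFun g)
    (hgmono : StrictMono g) : ¬ ConvexOn ℝ (Ici x₀) g := by
  intro hc
  obtain ⟨M, hM⟩ := hgb
  have hd : 0 < g (x₀ + 1) - g x₀ := sub_pos.mpr (hgmono (by linarith))
  have hM0 : 0 ≤ M := (abs_nonneg _).trans (hM 0)
  set n : ℝ := 2 * M / (g (x₀ + 1) - g x₀) + 1 with hn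
  have hn1 : 1 ≤ n := by
    have : 0 ≤ 2 * M / (g (x₀ + 1) - g x₀) := by positivity
    linarith
  have hn0 : 0 < n := by linarith
  have hmem : x₀ + n ∈ Ici x₀ := by simp [hn0.le]
  have hb0 : 0 ≤ 1 - 1 / n := by rw [sub_nonneg, div_le_one hn0]; exact hn1
  have hb1 : 0 ≤ 1 / n := by positivity
  have h1 := hc.2 self_mem_Ici hmem hb0 hb1 (by ring)
  simp only [smul_eq_mul] at h1
  rw [show (1 - 1 / n) * x₀ + 1 / n * (x₀ + n) = x₀ + 1 by field_simp; ring] at h1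
  have h2 : n * (g (x₀ + 1) - g x₀) ≤ g (x₀ + n) - g x₀ := by
    have h3 : g (x₀ + 1) - g x₀ ≤ (g (x₀ + n) - g x₀) / n := by
      rw [sub_le_iff_le_add]
      exact h1.trans (le_of_eq (by ring))
    rw [le_div_iff₀ hn0] at h3
    linarith
  have h4 : n * (g (x₀ + 1) - g x₀) = 2 * M + (g (x₀ + 1) - g x₀) := by
    rw [hn]; field_simp
  have h5 := abs_le.mp (hM (x₀ + n))
  have h6 := abs_le.mp (hM x₀)
  linarith

/-- Reduction to the normalised equation. -/
theorem exists_isBiNormalized {g p : ℝ → ℝ} {x₀ gm gp A : ℝ} (hg : ContDiff ℝ 2 g)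
    (hgb : IsBoundedFun g) (hgmono : StrictMono g) (hinfl : IsOnlyInflectionPoint g x₀)
    (hgm : Tendsto g atBot (𝓝 gm)) (hgp : Tendsto g atTop (𝓝 gp)) (hp : Continuous p)
    (hpb : IsBoundedFun p) (hA : HasAsymptoticAverage p A) (hlt : gm < A ∧ A < gp) :
    ∃ (M : ℝ) (α : Bool → ℝ) (K : NNReal), IsBiNormalized (fun x => g (x + x₀) - A)
      (fun x => deriv g (x + x₀)) (fun t => p t - A) M α K := by
  have hdiff : Differentiable ℝ g := hg.differentiable (by norm_num)
  obtain ⟨hcv, hcc⟩ : StrictConvexOn ℝ (Iic x₀) g ∧ StrictConcaveOn ℝ (Ici x₀) g :=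
    hinfl.resolve_right fun h => not_convexOn_Ici_of_bounded hgb hgmono h.2.convexOn
  have hmono := hcv.strictMonoOn_deriv fun x _ => hdiff x
  have hanti := hcc.strictAntiOn_deriv fun x _ => hdiff x
  have hd0 : ∀ x, 0 ≤ deriv g x := fun x => hgmono.monotone.deriv_nonneg
  -- `g'` is nonnegative and strictly monotone on each side of `x₀`; a vanishing value would force a
  -- negative one further out.
  have hdpos : ∀ x, 0 < deriv g x := by
    intro x
    rcases le_total x₀ x with h | h
    · exact (hd0 (x + 1)).trans_lt (hanti h (mem_Ici.mpr (by linarith)) (by linarith))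
    · exact (hd0 (x - 1)).trans_lt (hmono (mem_Iic.mpr (by linarith)) h (by linarith))
  have hdle : ∀ x, deriv g x ≤ deriv g x₀ := by
    intro x
    rcases le_total x₀ x with h | h
    · exact hanti.antitoneOn self_mem_Ici h h
    · exact hmono.monotoneOn h self_mem_Iic h
  have hlip : LipschitzWith (deriv g x₀).toNNReal g := by
    refine lipschitzWith_of_nnnorm_deriv_le hdiff fun x => ?_
    rw [← NNReal.coe_le_coe, coe_nnnorm, Real.coe_toNNReal _ (hd0 _), Real.norm_eq_abs,
      abs_of_nonneg (hd0 x)]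
    exact hdle x
  obtain ⟨Mg, hMg⟩ := hgb
  obtain ⟨Mp, hMp⟩ := hpb
  have hMg0 : 0 ≤ Mg := (abs_nonneg _).trans (hMg 0)
  have hMp0 : 0 ≤ Mp := (abs_nonneg _).trans (hMp 0)
  -- The limit `α` is the distance from `A` to `g(+∞)` for the original nonlinearity and to `g(-∞)`
  -- for the reflected one; condition (iii) is exactly the positivity of both.
  refine ⟨Mg + Mp + |A|, fun e => cond e (A - gm) (gp - A), (deriv g x₀).toNNReal, fun e => ?_⟩
  refine ⟨fun x => ?_, fun x y hxy => ?_, LipschitzWith.of_dist_le_mul fun x y => ?_, fun x => ?_,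
    fun x hx y hy hxy => ?_, fun x _ => hdpos _, ?_, ?_, by fun_prop, fun t => ?_, fun ε hε => ?_⟩
  · have h1 : HasDerivAt (fun x => boolSign e * x + x₀) (boolSign e * 1) x :=
      ((hasDerivAt_id x).const_mul _).add_const x₀
    refine ((((hdiff (boolSign e * x + x₀)).hasDerivAt.comp x h1).sub_const A).const_mul
      (boolSign e)).congr_deriv ?_
    rw [mul_one, mul_comm (deriv g _), ← mul_assoc, boolSign_mul_self, one_mul]
  · cases e
    · have := hgmono.monotone (show x + x₀ ≤ y + x₀ by linarith)
      simp only [boolSign, cond_false, one_mul]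
      linarith
    · have := hgmono.monotone (show -1 * y + x₀ ≤ -1 * x + x₀ by linarith)
      simp only [boolSign, cond_true]
      linarith
  · have h1 := hlip.dist_le_mul (boolSign e * x + x₀) (boolSign e * y + x₀)
    rw [Real.dist_eq, Real.dist_eq] at h1 ⊢
    rw [← mul_sub, abs_boolSign_mul, sub_sub_sub_cancel_right]
    rwa [add_sub_add_right_eq_sub, ← mul_sub, abs_boolSign_mul] at h1
  · rw [abs_boolSign_mul]
    exact (abs_sub _ _).trans (by linarith [hMg (boolSign e * x + x₀)])
  · have hx' : 0 ≤ x := hx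
    have hy' : 0 ≤ y := hy
    cases e
    · simp only [boolSign, cond_false, one_mul]
      exact hanti.antitoneOn (mem_Ici.mpr (by linarith)) (mem_Ici.mpr (by linarith)) (by linarith)
    · simp only [boolSign, cond_true]
      exact hmono.monotoneOn (mem_Iic.mpr (by linarith)) (mem_Iic.mpr (by linarith)) (by linarith)
  · cases e
    · simp only [boolSign, cond_false, one_mul]
      exact (hgp.comp (tendsto_atTop_add_const_right _ _ tendsto_id)).sub_const A
    · simp only [boolSign, cond_true, neg_mul, one_mul]
      have h1 : Tendsto (fun x : ℝ => -x + x₀) atTop atBot :=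
        tendsto_atBot_add_const_right _ _ tendsto_neg_atTop_atBot
      simpa using ((hgm.comp h1).sub_const A).neg
  · cases e
    · exact sub_pos.mpr hlt.2
    · exact sub_pos.mpr hlt.1
  · rw [abs_boolSign_mul]
    exact (abs_sub _ _).trans (by linarith [hMp t])
  · obtain ⟨S, hS⟩ := eventually_atTop.mp (Metric.tendstoUniformly_iff.mp hA ε hε)
    refine ⟨max S 1, by positivity, fun t T hT => ?_⟩
    have hT0 : 0 < T := zero_lt_one.trans_le ((le_max_right _ _).trans hT)
    have h1 := hS T ((le_max_left _ _).trans hT) t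
    rw [Real.dist_eq, abs_sub_comm] at h1
    have h2 : ∫ s in t..t + T, boolSign e * (p s - A)
        = boolSign e * (T * ((1 / T * ∫ s in t..t + T, p s) - A)) := by
      rw [intervalIntegral.integral_const_mul, intervalIntegral.integral_sub
        (hp.intervalIntegrable _ _) (by simp), intervalIntegral.integral_const, smul_eq_mul]
      congr 1
      field_simp
      ring
    rw [h2, abs_boolSign_mul, abs_mul, abs_of_pos hT0, mul_comm]
    exact mul_le_mul_of_nonneg_right h1.le hT0.le

/-- Arbitrarily large bounded oscillating solutions of the original equation. -/
theorem exists_large_solution {g p : ℝ → ℝ} {x₀ gm gp A : ℝ} (hg : ContDiff ℝ 2 g)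
    (hgb : IsBoundedFun g) (hgmono : StrictMono g) (hinfl : IsOnlyInflectionPoint g x₀)
    (hgm : Tendsto g atBot (𝓝 gm)) (hgp : Tendsto g atTop (𝓝 gp)) (hp : Continuous p)
    (hpb : IsBoundedFun p) (hA : HasAsymptoticAverage p A) (hlt : gm < A ∧ A < gp) (N : ℝ) :
    ∃ u : ℝ → ℝ, (IsSolution g p u ∧ IsBoundedFun u ∧ IsBoundedFun (deriv u) ∧
      {t : ℝ | u t = x₀}.Infinite ∧ {t : ℝ | u t = 0}.Infinite) ∧ N ≤ ⨆ t : ℝ, |u t| := by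
  obtain ⟨M, α, K, hbn⟩ := exists_isBiNormalized hg hgb hgmono hinfl hgm hgp hp hpb hA hlt
  -- The summand `|x₀|` places the level `-x₀` of `v`, that is the level `0` of `v + x₀`, within the
  -- oscillation, and keeps the supremum above `N` after translation.
  obtain ⟨H, hHN, hH, B, W, hW, v, v', hv, hvB, hosc⟩ := hbn.exists_oscillating (|N| + |x₀|)
  have hu : IsSecondOrderSol (fun t x => p t - g x) (fun t => v t + x₀) v' := fun t =>
    ⟨(hv t).1.add_const x₀, (hv t).2.congr_deriv (by ring)⟩
  have hx₀ : |x₀| ≤ H := by linarith [abs_nonneg N]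
  have hub : ∀ t, |v t + x₀| ≤ B + |x₀| := fun t =>
    (abs_add_le _ _).trans (by linarith [(hvB t).1])
  have hd : deriv (fun t => v t + x₀) = v' := funext fun t => (hu t).1.deriv
  refine ⟨fun t => v t + x₀, ⟨hu.isSolution hg.continuous hp, ⟨_, hub⟩, ⟨B, fun t => ?_⟩, ?_, ?_⟩, ?_⟩
  · rw [hd]; exact (hvB t).2
  · have := infinite_setOf_eq_of_oscillating hv.continuous hosc (y := 0) (by simpa using hH.le)
    simpa using this
  · have := infinite_setOf_eq_of_oscillating hv.continuous hosc (y := -x₀) (by simpa using hx₀)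
    simpa [eq_neg_iff_add_eq_zero] using this
  · obtain ⟨t, -, ht⟩ := (hosc 0).1
    have h1 : |v t + x₀| ≤ ⨆ t : ℝ, |v t + x₀| :=
      le_ciSup (f := fun t => |v t + x₀|) ⟨B + |x₀|, by rintro _ ⟨t, rfl⟩; exact hub t⟩ t
    linarith [le_abs_self (v t + x₀), neg_abs_le x₀, le_abs_self N]

theorem theorem1p1 (g p : ℝ → ℝ) (x₀ gm gp A : ℝ)
    (hg : ContDiff ℝ 2 g) (hgb : IsBoundedFun g) (hgmono : StrictMono g)
    (hinfl : IsOnlyInflectionPoint g x₀)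
    -- `gm = g(-∞)` and `gp = g(+∞)`
    (hgm : Tendsto g atBot (𝓝 gm)) (hgp : Tendsto g atTop (𝓝 gp))
    (hp : Continuous p) (hpb : IsBoundedFun p) (hA : HasAsymptoticAverage p A) :
    ((∃ u : ℝ → ℝ, IsSolution g p u ∧ IsBoundedFun u) ↔ (gm < A ∧ A < gp)) ∧
    ((∃ u : ℝ → ℝ, IsSolution g p u ∧ IsBoundedFun u ∧ IsBoundedFun (deriv u)) ↔
      (gm < A ∧ A < gp)) ∧
    ((gm < A ∧ A < gp) →
      ∃ u : ℕ → ℝ → ℝ,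
        (∀ m : ℕ, IsSolution g p (u m) ∧ IsBoundedFun (u m) ∧ IsBoundedFun (deriv (u m)) ∧
          {t : ℝ | u m t = x₀}.Infinite ∧ {t : ℝ | u m t = 0}.Infinite) ∧
        Tendsto (fun m : ℕ => ⨆ t : ℝ, |u m t|) atTop atTop) := by
  have hnec : ∀ u, IsSolution g p u → IsBoundedFun u → gm < A ∧ A < gp := fun u hu hub =>
    hu.average_mem_Ioo hg.continuous hgb hgmono hgm hgp hp hpb hA hub
  have hsuf := exists_large_solution hg hgb hgmono hinfl hgm hgp hp hpb hA
  refine ⟨⟨fun ⟨u, hu, hub⟩ => hnec u hu hub, fun hlt => ?_⟩,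
    ⟨fun ⟨u, hu, hub, _⟩ => hnec u hu hub, fun hlt => ?_⟩, fun hlt => ?_⟩
  · obtain ⟨u, ⟨hu, hub, -⟩, -⟩ := hsuf hlt 0
    exact ⟨u, hu, hub⟩
  · obtain ⟨u, ⟨hu, hub, hub', -⟩, -⟩ := hsuf hlt 0
    exact ⟨u, hu, hub, hub'⟩
  · choose u hu hsup using fun m : ℕ => hsuf hlt m
    exact ⟨u, hu, tendsto_atTop_mono hsup tendsto_natCast_atTop_atTop⟩
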